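/- **Theorem 3.1.** Let $X$ be a locally finite, purely $n$-dimensional simplicial complex (every simplex is a face of an $n$-simplex, and there are no simplices of dimension $>n$). Let $\mathrm{Aut}(X)$ be its group of simplicial automorphisms with the compact-open topology (the pointwise stabilizers of finite sets of vertices form a basis of neighbourhoods of the identity), and let $G\le \mathrm{Aut}(X)$ be a closed subgroup that is unimodular and acts cocompactly (finitely many orbits of simplices). Assume that $X$ is connected or, if it is not, that the stabilizers in $G$ of the vertices of $X$ are compact. For a simplex $\tau$ of dimension $<n$ let $X_\tau$ be its link, a complex of dimension $d=n-\dim\tau-1$. For a simplex $\eta$ of $X_\tau$ let $m_\tau(\eta)$ be the number of $d$-simplices of $X_\tau$ containing $\eta$, let $$(\Delta_\tau f)(v)=\sum_{w:\ \{v,w\}\in X_\tau,\ w\ne v}\frac{m_\tau(\{v,w\})}{m_\tau(\{v\})}\,\bigl(f(v)-f(w)\bigr)$$ be the Laplacian on the space $C^0(X_\tau,\mathbb R)$ of real functions on the vertices of $X_\tau$, and let $\kappa_\tau$ be its smallest positive eigenvalue. For a unitary representation $\rho$ of $G$ on a complex Hilbert space $\mathcal H$ let $C^k(X,\rho)$ be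 the space of alternating maps $\varphi$ from ordered $k$-simplices of $X$ to $\mathcal H$ with $\varphi(g\sigma)=\rho(g)\varphi(\sigma)$ for all $g\in G$ and all $\sigma$, with the differential $(d\varphi)(\sigma)=\sum_{i=0}^{k+1}(-1)^i\varphi(\sigma_i)$, where $\sigma_i$ is the ordered simplex $\sigma=(v_0,\dots,v_{k+1})$ with $v_i$ omitted. Let $1\le k\le n-1$, and suppose that for every $(k-1)$-dimensional simplex $\tau$ of $X$ the link $X_\tau$ is connected and $$\kappa_\tau>\frac{k(n-k)}{k+1}.$$ Then $H^k(C^*(X,\rho))=0$ for every unitary representation $\rho$ of $G$ (which need not be assumed continuous). -/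

import Mathlib

universe u v

namespace AbstractSimplicialComplex

variable {V : Type u}

/-! ### Simplicial complexes -/

theorem mem_of_subset (X : AbstractSimplicialComplex V) {s t : Finset V} (hs : s ∈ X)
    (hts : t ⊆ s) (ht : t.Nonempty) : t ∈ X :=
  (X.isRelLowerSet_faces hs).2 hts ht

theorem nonempty_of_mem (X : AbstractSimplicialComplex V) {s : Finset V} (hs : s ∈ X) :
    s.Nonempty :=
  (X.isRelLowerSet_faces hs).1

/-- Every vertex lies in only finitely many simplices. -/
class IsLocallyFinite (X : AbstractSimplicialComplex V) : Prop where
  finite_star : ∀ v : V, {s : Finset V | s ∈ X ∧ v ∈ s}.Finite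

/-- `X` is purely `n`-dimensional: it has no simplex of dimension greater than `n`
(a simplex of dimension `k` has `k + 1` vertices), and every simplex is a face of an
`n`-dimensional one. -/
structure IsPure (X : AbstractSimplicialComplex V) (n : ℕ) : Prop where
  card_le : ∀ s ∈ X, s.card ≤ n + 1
  exists_top : ∀ s ∈ X, ∃ t ∈ X, s ⊆ t ∧ t.card = n + 1

/-- The `1`-skeleton, as a graph on the vertices. -/
def edgeGraph (X : AbstractSimplicialComplex V) : SimpleGraph V where
  Adj v w := v ≠ w ∧ ∃ s ∈ X, v ∈ s ∧ w ∈ s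
  symm := ⟨fun _ _ h => ⟨h.1.symm, h.2.imp fun _ hs => ⟨hs.1, hs.2.2, hs.2.1⟩⟩⟩
  loopless := ⟨fun _ h => h.1 rfl⟩

/-- A complex is connected if it is non-empty and any two vertices are joined by an edge path. -/
def IsConnected (X : AbstractSimplicialComplex V) : Prop :=
  X.edgeGraph.Connected

/-! ### Links -/

/-- The vertices of the link of `τ`: the vertices `v ∉ τ` such that `τ ∪ {v}` is a simplex. -/
def LinkVertex (X : AbstractSimplicialComplex V) (τ : X.faces) : Type u :=
  {v : V // v ∉ τ.1 ∧ ∃ s ∈ X, v ∈ s ∧ τ.1 ⊆ s}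

/-- The simplex of `X` spanned by `τ` and a set `η` of vertices of its link, as a vertex set. -/
noncomputable def join (X : AbstractSimplicialComplex V) (τ : X.faces)
    (η : Finset (X.LinkVertex τ)) : Finset V :=
  open Classical in τ.1 ∪ η.map ⟨Subtype.val, Subtype.val_injective⟩

/-- The link of a simplex `τ`: its simplices are the non-empty sets `η` of vertices outside `τ`
such that `τ ∪ η` is a simplex of `X`. -/
noncomputable def link (X : AbstractSimplicialComplex V) (τ : X.faces) :
    AbstractSimplicialComplex (X.LinkVertex τ) where
  faces := {η | η.Nonempty ∧ X.join τ η ∈ X}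
  isRelLowerSet_faces := by
    classical
    intro η hη
    refine ⟨hη.1, fun θ hθη hθ => ⟨hθ, X.mem_of_subset hη.2 ?_ ?_⟩⟩
    · exact Finset.union_subset_union_right (Finset.map_subset_map.2 hθη)
    · exact (X.nonempty_of_mem τ.2).mono Finset.subset_union_left
  singleton_mem := by
    classical
    rintro ⟨v, hv, s, hs, hvs, hτs⟩
    refine ⟨Finset.singleton_nonempty _, X.mem_of_subset hs ?_ ?_⟩
    · intro w hw
      rcases Finset.mem_union.1 hw with hw | hw
      · exact hτs hw
      · obtain ⟨x, hx, rfl⟩ := Finset.mem_map.1 hw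
        rw [Finset.mem_singleton.1 hx]
        exact hvs
    · exact (X.nonempty_of_mem τ.2).mono Finset.subset_union_left

instance (X : AbstractSimplicialComplex V) [X.IsLocallyFinite] (τ : X.faces) :
    Finite (X.LinkVertex τ) := by
  obtain ⟨w, hw⟩ := X.nonempty_of_mem τ.2
  have h := (IsLocallyFinite.finite_star (X := X) w).biUnion (t := fun s => (s : Set V))
    fun s _ => s.finite_toSet
  refine Set.Finite.to_subtype (h.subset ?_)
  rintro v ⟨_, s, hs, hvs, hτs⟩
  exact Set.mem_biUnion (x := s) ⟨hs, hτs hw⟩ hvs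

/-! ### The Laplacian on `0`-cochains and its smallest positive eigenvalue -/

section Laplacian

variable {W : Type v}

/-- The weight `m(η)` of a simplex in a complex of dimension `d`: the number of `d`-dimensional
simplices that contain it. -/
noncomputable def weight (Y : AbstractSimplicialComplex W) (d : ℕ) (η : Finset W) : ℕ :=
  {s : Finset W | s ∈ Y ∧ η ⊆ s ∧ s.card = d + 1}.ncard

open Classical in
/-- The Laplacian `Δ = δ d` on real `0`-cochains of a finite purely `d`-dimensional complex, where
`δ` is the adjoint of the coboundary `d` for the inner products that weight every (unordered)
simplex `η` by `m(η)`: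
`(Δ f)(v) = ∑ (m({v, w}) / m({v})) * (f v - f w)`, the sum being over the vertices `w` adjacent
to `v`. -/
noncomputable def vertexLaplacian (Y : AbstractSimplicialComplex W) [Finite W] (d : ℕ) :
    Module.End ℝ (W → ℝ) :=
  letI := Fintype.ofFinite W
  { toFun := fun f v => ∑ w with Y.edgeGraph.Adj v w,
      ((Y.weight d {v, w} : ℝ) / (Y.weight d {v} : ℝ)) * (f v - f w)
    map_add' := by
      intro f g
      funext v
      simp only [Pi.add_apply, ← Finset.sum_add_distrib]
      exact Finset.sum_congr rfl fun w _ => by ring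
    map_smul' := by
      intro c f
      funext v
      simp only [Pi.smul_apply, smul_eq_mul, RingHom.id_apply, Finset.mul_sum]
      exact Finset.sum_congr rfl fun w _ => by ring }

end Laplacian

/-- `κ_τ`: the smallest positive eigenvalue of the Laplacian on the real `0`-cochains of the link
of `τ`, where `X` is purely `n`-dimensional, so that the link of `τ` has dimension
`n - dim τ - 1 = n - card τ`. (If there is no positive eigenvalue, this is `0`; that does not
happen when the link is connected of positive dimension.) -/
noncomputable def kappa (X : AbstractSimplicialComplex V) [X.IsLocallyFinite] (n : ℕ)
    (τ : X.faces) : ℝ :=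
  sInf {μ : ℝ | 0 < μ ∧ ((X.link τ).vertexLaplacian (n - τ.1.card)).HasEigenvalue μ}

/-! ### Groups of simplicial automorphisms -/

/-- The group of simplicial automorphisms of `X`: the permutations of the vertices which map
simplices to simplices, in both directions. -/
def Aut (X : AbstractSimplicialComplex V) : Subgroup (Equiv.Perm V) where
  carrier := {g | ∀ s : Finset V, s.map g.toEmbedding ∈ X ↔ s ∈ X}
  one_mem' := by
    intro s
    have h : s.map (1 : Equiv.Perm V).toEmbedding = s := Finset.map_refl
    rw [h]
  mul_mem' := by
    intro g h hg hh s
    have e : s.map (g * h).toEmbedding = (s.map h.toEmbedding).map g.toEmbedding := by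
      rw [Finset.map_map]; rfl
    rw [e, hg, hh]
  inv_mem' := by
    intro g hg s
    have e : (s.map (g⁻¹).toEmbedding).map g.toEmbedding = s := by
      rw [Finset.map_map]
      ext; simp
    rw [← hg, e]

/-- The compact-open topology on the automorphism group, i.e. the topology of pointwise
convergence on the discrete set of vertices: the pointwise stabilizers of finite sets of vertices
are a basis of neighbourhoods of the identity. -/
instance (X : AbstractSimplicialComplex V) : TopologicalSpace X.Aut :=
  ⨅ x : V, TopologicalSpace.induced (fun g : X.Aut => g.1 x) ⊥

theorem isOpen_setOf_apply_eq (X : AbstractSimplicialComplex V) (x y : V) :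
    IsOpen {g : X.Aut | g.1 x = y} := by
  have h : (TopologicalSpace.induced (fun g : X.Aut => g.1 x) ⊥).IsOpen
      {g : X.Aut | g.1 x = y} :=
    ⟨{y}, trivial, rfl⟩
  exact (iInf_le (fun x : V => TopologicalSpace.induced (fun g : X.Aut => g.1 x) ⊥) x) _ h

theorem continuous_aut_iff (X : AbstractSimplicialComplex V) {T : Type*} [TopologicalSpace T]
    {F : T → X.Aut} : Continuous F ↔ ∀ x y : V, IsOpen {t | (F t).1 x = y} := by
  constructor
  · intro h x y
    exact (X.isOpen_setOf_apply_eq x y).preimage h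
  · intro h
    let _ : TopologicalSpace V := ⊥
    refine continuous_iInf_rng.2 fun x => continuous_induced_rng.2 ⟨fun s _ => ?_⟩
    have e : ((fun g : X.Aut => g.1 x) ∘ F) ⁻¹' s = ⋃ y ∈ s, {t | (F t).1 x = y} := by
      ext; simp
    rw [e]
    exact isOpen_biUnion fun y _ => h x y

instance (X : AbstractSimplicialComplex V) : IsTopologicalGroup X.Aut where
  continuous_mul := by
    refine X.continuous_aut_iff.2 fun x y => ?_
    have e : {p : X.Aut × X.Aut | (p.1 * p.2).1 x = y} =
        ⋃ z : V, {g : X.Aut | g.1 z = y} ×ˢ {h : X.Aut | h.1 x = z} := by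
      ext p
      simp
    rw [e]
    exact isOpen_iUnion fun z =>
      (X.isOpen_setOf_apply_eq z y).prod (X.isOpen_setOf_apply_eq x z)
  continuous_inv := by
    refine X.continuous_aut_iff.2 fun x y => ?_
    have e : {g : X.Aut | (g⁻¹).1 x = y} = {g : X.Aut | g.1 y = x} := by
      ext g
      exact Equiv.Perm.inv_eq_iff_eq.trans eq_comm
    rw [e]
    exact X.isOpen_setOf_apply_eq y x

/-- The stabilizer in `G` of a vertex. -/
def vertexStabilizer {X : AbstractSimplicialComplex V} (G : Subgroup X.Aut) (x : V) : Set G :=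
  {g | g.1.1 x = x}

/-- `G` acts cocompactly on `X`: there are finitely many simplices whose translates by `G` are all
the simplices. -/
def IsCocompact {X : AbstractSimplicialComplex V} (G : Subgroup X.Aut) : Prop :=
  ∃ F : Set (Finset V), F.Finite ∧
    ∀ s ∈ X, ∃ g : G, s.map g.1.1.toEmbedding ∈ F

/-! ### Ordered simplices -/

/-- The ordered `k`-simplices `(v₀, …, v_k)` of `X`. -/
def OrderedSimplex (X : AbstractSimplicialComplex V) (k : ℕ) : Type u :=
  {σ : Fin (k + 1) ↪ V // Finset.univ.map σ ∈ X}

namespace OrderedSimplex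

variable {X : AbstractSimplicialComplex V} {k : ℕ}

@[ext]
theorem ext {σ τ : X.OrderedSimplex k} (h : ∀ i, σ.1 i = τ.1 i) : σ = τ :=
  Subtype.ext (Function.Embedding.ext h)

/-- The ordered simplex `(v_{π 0}, …, v_{π k})`. -/
def permute (σ : X.OrderedSimplex k) (π : Equiv.Perm (Fin (k + 1))) : X.OrderedSimplex k :=
  ⟨π.toEmbedding.trans σ.1, by
    rw [← Finset.map_map, Finset.map_univ_equiv]
    exact σ.2⟩

/-- The face `(v₀, …, v_{i-1}, v_{i+1}, …, v_{k+1})`. -/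
def face (σ : X.OrderedSimplex (k + 1)) (i : Fin (k + 2)) : X.OrderedSimplex k :=
  ⟨(i.succAboveEmb).trans σ.1, by
    refine X.mem_of_subset σ.2 ?_ (Finset.univ_nonempty.map)
    rw [← Finset.map_map]
    exact Finset.map_subset_map.2 (Finset.subset_univ _)⟩

/-- The translate `(g v₀, …, g v_k)`. -/
def translate (g : X.Aut) (σ : X.OrderedSimplex k) : X.OrderedSimplex k :=
  ⟨σ.1.trans g.1.toEmbedding, by
    rw [← Finset.map_map]
    exact (g.2 _).2 σ.2⟩

theorem translate_face (g : X.Aut) (σ : X.OrderedSimplex (k + 1)) (i : Fin (k + 2)) :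
    (translate g σ).face i = translate g (σ.face i) := rfl

theorem face_face (σ : X.OrderedSimplex (k + 2)) (i : Fin (k + 3)) (j : Fin (k + 2)) :
    (σ.face (i.succAbove j)).face (j.predAbove i) = (σ.face i).face j := by
  ext l
  exact congrArg σ.1 (Fin.succAbove_succAbove_succAbove_predAbove i j l)

/-- Deleting the `i`-th vertex of a permuted simplex amounts to deleting the `π i`-th vertex and
permuting. -/
theorem exists_permute_face (π : Equiv.Perm (Fin (k + 2))) (i : Fin (k + 2)) :
    ∃ π' : Equiv.Perm (Fin (k + 1)),
      (∀ j, π (i.succAbove j) = (π i).succAbove (π' j)) ∧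
      (Equiv.Perm.sign π' : ℤ) = (-1) ^ (i : ℕ) * (-1) ^ (π i : ℕ) * Equiv.Perm.sign π := by
  set θ : Equiv.Perm (Fin (k + 2)) := (π i).cycleRange * π * (i.cycleRange)⁻¹ with hθ
  have hθ0 : θ 0 = 0 := by
    simp [hθ]
  obtain ⟨⟨p, π'⟩, hp⟩ := Equiv.Perm.decomposeFin.symm.surjective θ
  have hp0 : p = 0 := by
    rw [← Equiv.Perm.decomposeFin_symm_apply_zero p π', hp, hθ0]
  subst hp0
  refine ⟨π', fun j => ?_, ?_⟩
  · have h1 : θ j.succ = (π' j).succ := by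
      rw [← hp, Equiv.Perm.decomposeFin_symm_apply_succ]; simp
    have h2 : (π i).cycleRange (π (i.succAbove j)) = (π' j).succ := by
      rw [← h1]; simp [hθ]
    rw [← Fin.cycleRange_symm_succ (π i), ← h2, Equiv.symm_apply_apply]
  · have h1 : Equiv.Perm.sign π' = Equiv.Perm.sign θ := by
      rw [← hp, Equiv.Perm.decomposeFin.symm_sign]; simp
    rw [h1, hθ]
    simp only [Equiv.Perm.sign_mul, Equiv.Perm.sign_inv, Fin.sign_cycleRange]
    push_cast
    ring

end OrderedSimplex

/-! ### Cochains with coefficients in a unitary representation -/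

section Cochains

variable {X : AbstractSimplicialComplex V} {G : Subgroup X.Aut}
  {H : Type v} [NormedAddCommGroup H] [InnerProductSpace ℂ H]

/-- `C^k(X, ρ)`: the alternating maps `φ` from ordered `k`-simplices to `H` which satisfy
`φ (g σ) = ρ(g) (φ σ)` for all `g` in `G`. -/
def cochains (ρ : G →* (H ≃ₗᵢ[ℂ] H)) (k : ℕ) : Submodule ℂ (X.OrderedSimplex k → H) where
  carrier := {φ |
    (∀ (π : Equiv.Perm (Fin (k + 1))) (σ : X.OrderedSimplex k),
      φ (σ.permute π) = ((Equiv.Perm.sign π : ℤ) : ℂ) • φ σ) ∧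
    ∀ (g : G) (σ : X.OrderedSimplex k), φ (σ.translate g.1) = ρ g (φ σ)}
  zero_mem' := by constructor <;> simp
  add_mem' := by
    rintro φ ψ ⟨h1, h2⟩ ⟨h3, h4⟩
    constructor
    · intro π σ
      simp only [Pi.add_apply, h1 π σ, h3 π σ, smul_add]
    · intro g σ
      simp only [Pi.add_apply, h2 g σ, h4 g σ, map_add]
  smul_mem' := by
    rintro c φ ⟨h1, h2⟩
    constructor
    · intro π σ
      simp only [Pi.smul_apply, h1 π σ, smul_comm c]
    · intro g σ
      simp only [Pi.smul_apply, h2 g σ, map_smul]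

/-- The differential `(d φ)(σ) = ∑ i, (-1)^i φ(σ_i)`, with `σ_i` the `i`-th face of `σ`. -/
def cochainDifferential (ρ : G →* (H ≃ₗᵢ[ℂ] H)) (k : ℕ) :
    cochains ρ k →ₗ[ℂ] cochains ρ (k + 1) where
  toFun φ := ⟨fun σ => ∑ i : Fin (k + 2), (-1 : ℂ) ^ (i : ℕ) • φ.1 (σ.face i), by
    constructor
    · intro π σ
      rw [Finset.smul_sum, ← Equiv.sum_comp π fun i =>
        ((Equiv.Perm.sign π : ℤ) : ℂ) • (-1 : ℂ) ^ (i : ℕ) • φ.1 (σ.face i)]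
      refine Finset.sum_congr rfl fun i _ => ?_
      obtain ⟨π', h1, h2⟩ := OrderedSimplex.exists_permute_face π i
      have e : (σ.permute π).face i = (σ.face (π i)).permute π' := by
        ext j
        exact congrArg σ.1 (h1 j)
      rw [e, φ.2.1, h2, smul_smul, smul_smul]
      congr 1
      push_cast
      have hs : ((-1 : ℂ) ^ (i : ℕ)) * (-1) ^ (i : ℕ) = 1 := by
        rw [← mul_pow]; simp
      linear_combination ((-1 : ℂ) ^ (π i : ℕ) * ((Equiv.Perm.sign π : ℤ) : ℂ)) * hs
    · intro g σ
      simp only [OrderedSimplex.translate_face, φ.2.2, map_sum, map_smul]⟩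
  map_add' φ ψ := by
    ext σ
    simp [Finset.sum_add_distrib]
  map_smul' c φ := by
    ext σ
    simp [Finset.smul_sum, smul_comm c]

theorem cochainDifferential_comp (ρ : G →* (H ≃ₗᵢ[ℂ] H)) (k : ℕ) (φ : cochains ρ k) :
    cochainDifferential ρ (k + 1) (cochainDifferential ρ k φ) = 0 := by
  ext σ
  change ∑ i : Fin (k + 3), (-1 : ℂ) ^ (i : ℕ) •
    ∑ j : Fin (k + 2), (-1 : ℂ) ^ (j : ℕ) • φ.1 ((σ.face i).face j) = 0
  simp only [Finset.smul_sum, smul_smul, ← pow_add]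
  rw [← Finset.sum_product']
  refine Finset.sum_involution (fun p _ => (p.1.succAbove p.2, p.2.predAbove p.1)) ?_ ?_ ?_ ?_
  · rintro ⟨i, j⟩ _
    simp only [OrderedSimplex.face_face, Fin.neg_one_pow_succAbove_add_predAbove]
    rw [neg_smul, add_neg_cancel]
  · rintro ⟨i, j⟩ _ _ h
    exact Fin.succAbove_ne i j (congrArg Prod.fst h)
  · intros
    simp
  · rintro ⟨i, j⟩ _
    simp [Fin.succAbove_succAbove_predAbove, Fin.predAbove_predAbove_succAbove]

/-- The cochain complex `C^*(X, ρ)` of complex vector spaces. -/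
noncomputable def cochainComplex (ρ : G →* (H ≃ₗᵢ[ℂ] H)) :
    CochainComplex (ModuleCat.{max u v} ℂ) ℕ :=
  CochainComplex.of (fun k => ModuleCat.of ℂ (cochains ρ k))
    (fun k => ModuleCat.ofHom (cochainDifferential ρ k))
    (fun k => by
      ext φ : 2
      exact cochainDifferential_comp ρ k φ)

end Cochains

end AbstractSimplicialComplex

/-- A topological group is unimodular if it has a (left) Haar measure that is also invariant under
right translations. -/
def IsUnimodularGroup (G : Type u) [Group G] [TopologicalSpace G] : Prop :=
  letI : MeasurableSpace G := borel G
  ∃ μ : MeasureTheory.Measure G, μ.IsHaarMeasure ∧ μ.IsMulRightInvariant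

/-! This is Garland's method with coefficients. Weight a simplex σ by the number m(σ) of n-simplices
containing it. Since ρ is unitary, m(σ)⟨φ(σ), ψ(σ)⟩ is G-invariant, and summing it over the finitely
many orbits, each divided by the Haar measure of a stabilizer, gives an inner product on cochains.
Compactness of vertex stabilizers makes these measures finite; unimodularity makes them constant on
orbits and yields the Fubini formula `IsProperSmul.orbitSum_eq_orbitSum_fiber`, which moves sums
between simplices and their faces.

Let φ be a k-cocycle. On the link of a (k-1)-simplex τ it defines the function v ↦ φ(vτ). By Fubini,
summing over τ the weighted square norm of this function gives ‖φ‖². Its weighted mean is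
δφ(τ)/(n-k+1), with δ the codifferential. Its energy sums to ‖φ‖² k(n-k)/(k+1): expand |φ(σ_0) -
φ(σ_1)|² over (k+1)-simplices σ and evaluate the cross term by pairing dφ = 0 with φ(σ_0)
(`IsOrbitCover.orbitSum_energy`).

The Poincaré inequality in each link (`mul_variance_le_of_le_kappa`) bounds variance times κ by
energy. If κ > k(n-k)/(k+1), this forces ε‖φ‖² ≤ ‖δφ‖² with ε > 0 independent of φ
(`IsOrbitCover.exists_mul_cochainNormSq_le`). Hence dδ is symmetric and coercive on the Hilbert
space of cocycles, so it is surjective there, and every cocycle is d of something. Only the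
individual isometries ρ(g) enter, so continuity of ρ plays no role. -/

/-! ### Weighted sums over orbits of a proper action -/

section OrbitSum

open MeasureTheory

variable {G : Type*} [Group G] [MeasurableSpace G]

/-- An action is proper and smooth for the measure `μ` if all transporters `{g | g • s = t}` are
measurable and all stabilizers have positive finite measure. -/
structure IsProperSmul (μ : Measure G) (S : Type*) [MulAction G S] : Prop where
  measurableSet : ∀ s t : S, MeasurableSet {g : G | g • s = t}
  pos : ∀ s : S, 0 < μ {g : G | g • s = s}
  lt_top : ∀ s : S, μ {g : G | g • s = s} < ⊤

/-- The measure of the set of group elements that carry `s` to `t`. -/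
noncomputable def transporter (μ : Measure G) {S : Type*} [MulAction G S] (s t : S) : ℝ :=
  μ.real {g : G | g • s = t}

/-- The measure of the set of group elements that carry `s` into `R`. -/
noncomputable def orbitMass (μ : Measure G) {S : Type*} [MulAction G S] (R : Finset S) (s : S) :
    ℝ :=
  ∑ r ∈ R, transporter μ s r

/-- The sum of an invariant function over the orbits of `G`, each orbit being weighted by the
inverse of the measure of a stabilizer; `R` is any finite set that meets all orbits. -/
noncomputable def orbitSum (μ : Measure G) {S : Type*} [MulAction G S] (R : Finset S)
    {E : Type*} [AddCommGroup E] [Module ℝ E] (F : S → E) : E :=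
  ∑ r ∈ R, (orbitMass μ R r)⁻¹ • F r

variable {μ : Measure G} {S T : Type*} [MulAction G S] [MulAction G T]

theorem transporter_nonneg (s t : S) : 0 ≤ transporter μ s t := measureReal_nonneg

theorem transporter_eq_zero {s t : S} (h : ∀ g : G, g • s ≠ t) : transporter μ s t = 0 := by
  have h : {g : G | g • s = t} = ∅ := by
    ext g; simp [h g]
  rw [transporter, h, measureReal_empty]

theorem IsProperSmul.transporter_self_pos (h : IsProperSmul μ S) (s : S) : 0 < transporter μ s s :=
  ENNReal.toReal_pos (h.pos s).ne' (h.lt_top s).ne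

section Linear

variable {E : Type*} [AddCommGroup E] [Module ℝ E] (R : Finset S)

theorem orbitSum_add (F F' : S → E) :
    orbitSum μ R (fun s => F s + F' s) = orbitSum μ R F + orbitSum μ R F' := by
  simp only [orbitSum, smul_add, Finset.sum_add_distrib]

theorem orbitSum_sum {ι : Type*} (I : Finset ι) (F : ι → S → E) :
    orbitSum μ R (fun s => ∑ i ∈ I, F i s) = ∑ i ∈ I, orbitSum μ R (F i) := by
  simp only [orbitSum, Finset.smul_sum]
  rw [Finset.sum_comm]

theorem orbitSum_map {E' : Type*} [AddCommGroup E'] [Module ℝ E'] (L : E →ₗ[ℝ] E') (F : S → E) :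
    orbitSum μ R (fun s => L (F s)) = L (orbitSum μ R F) := by
  simp only [orbitSum, map_sum, map_smul]

theorem orbitSum_const_mul (c : ℝ) (F : S → ℝ) :
    orbitSum μ R (fun s => c * F s) = c * orbitSum μ R F := by
  simp only [orbitSum, smul_eq_mul, Finset.mul_sum, mul_left_comm c]

theorem orbitSum_sub (F F' : S → E) :
    orbitSum μ R (fun s => F s - F' s) = orbitSum μ R F - orbitSum μ R F' := by
  simp only [orbitSum, smul_sub, Finset.sum_sub_distrib]

theorem orbitSum_mono {R : Finset S} {F F' : S → ℝ} (h : ∀ s ∈ R, F s ≤ F' s) :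
    orbitSum μ R F ≤ orbitSum μ R F' :=
  Finset.sum_le_sum fun s hs => smul_le_smul_of_nonneg_left (h s hs)
    (inv_nonneg.2 (Finset.sum_nonneg fun _ _ => transporter_nonneg _ _))

end Linear

variable [MeasurableMul G]

theorem transporter_smul_left [μ.IsMulRightInvariant] (g : G) (s t : S) :
    transporter μ (g • s) t = transporter μ s t := by
  have h : {h : G | h • g • s = t} = (fun h => h * g) ⁻¹' {h : G | h • s = t} := by
    ext h; simp [mul_smul]
  rw [transporter, transporter, Measure.real, Measure.real, h, measure_preimage_mul_right]

theorem transporter_smul_right [μ.IsMulLeftInvariant] (g : G) (s t : S) :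
    transporter μ s (g • t) = transporter μ s t := by
  have h : {h : G | h • s = g • t} = (fun h => g⁻¹ * h) ⁻¹' {h : G | h • s = t} := by
    ext h; simp [mul_smul, inv_smul_eq_iff]
  rw [transporter, transporter, Measure.real, Measure.real, h, measure_preimage_mul]

/-- This is where unimodularity acts: left invariance reduces one side to the stabilizer of `s`,
right invariance the other. -/
theorem transporter_comm [μ.IsMulLeftInvariant] [μ.IsMulRightInvariant] (s t : S) :
    transporter μ s t = transporter μ t s := by
  by_cases h : ∃ g : G, g • s = t
  · obtain ⟨g, rfl⟩ := h
    rw [transporter_smul_left, transporter_smul_right]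
  · push Not at h
    rw [transporter_eq_zero h, transporter_eq_zero]
    intro g hg
    exact h g⁻¹ (by rw [← hg, inv_smul_smul])

/-- For bi-invariant `μ`, the orbit mass is the stabilizer measure times the number of points of `R`
in the orbit. Points of `R` in one orbit therefore share its weight equally, and `R` need not be a
transversal. -/
theorem orbitMass_smul [μ.IsMulRightInvariant] (R : Finset S) (g : G) (s : S) :
    orbitMass μ R (g • s) = orbitMass μ R s := by
  simp only [orbitMass, transporter_smul_left]

namespace IsProperSmul

theorem measure_ne_top [μ.IsMulLeftInvariant] (h : IsProperSmul μ S) (s t : S) :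
    μ {g : G | g • s = t} ≠ ⊤ := by
  by_cases hg : ∃ g : G, g • s = t
  · obtain ⟨g, rfl⟩ := hg
    have e : {h : G | h • s = g • s} = (fun h => g⁻¹ * h) ⁻¹' {h : G | h • s = s} := by
      ext h; simp [mul_smul, inv_smul_eq_iff]
    rw [e, measure_preimage_mul]
    exact (h.lt_top s).ne
  · push Not at hg
    have e : {g : G | g • s = t} = ∅ := by
      ext g; simp [hg g]
    simp [e]

theorem orbitMass_pos [μ.IsMulRightInvariant] (h : IsProperSmul μ S)
    {R : Finset S} (hR : ∀ s, ∃ g : G, g • s ∈ R) (s : S) : 0 < orbitMass μ R s := by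
  obtain ⟨g, hg⟩ := hR s
  rw [← orbitMass_smul R g s]
  exact Finset.sum_pos' (fun _ _ => transporter_nonneg _ _)
    ⟨g • s, hg, h.transporter_self_pos _⟩

/-- An element carrying `p t` to `s` carries `t` to exactly one point of the fibre over `s`. -/
theorem transporter_map [μ.IsMulLeftInvariant] (hT : IsProperSmul μ T)
    {p : T → S} (hp : ∀ (g : G) t, p (g • t) = g • p t) {fib : S → Finset T}
    (hfib : ∀ s t, t ∈ fib s ↔ p t = s) (t : T) (s : S) :
    transporter μ (p t) s = ∑ t' ∈ fib s, transporter μ t t' := by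
  have e : {g : G | g • p t = s} = ⋃ t' ∈ fib s, {g : G | g • t = t'} := by
    ext g; simp [hfib, hp]
  rw [transporter, e, measureReal_biUnion_finset ?_ (fun t' _ => hT.measurableSet t t')
    (fun t' _ => hT.measure_ne_top t t')]
  · rfl
  · intro a _ b _ hab
    refine Set.disjoint_left.2 fun g hg hg' => hab ?_
    exact Eq.trans (Eq.symm hg) hg'

/-- Fubini's theorem for an equivariant map with finite fibres. -/
theorem orbitSum_eq_orbitSum_fiber [μ.IsMulLeftInvariant] [μ.IsMulRightInvariant]
    (hS : IsProperSmul μ S) (hT : IsProperSmul μ T) {p : T → S}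
    (hp : ∀ (g : G) t, p (g • t) = g • p t) {fib : S → Finset T}
    (hfib : ∀ s t, t ∈ fib s ↔ p t = s) {RS : Finset S} (hRS : ∀ s, ∃ g : G, g • s ∈ RS)
    {RT : Finset T} (hRT : ∀ t, ∃ g : G, g • t ∈ RT) {E : Type*} [AddCommGroup E] [Module ℝ E]
    {F : T → E} (hF : ∀ (g : G) t, F (g • t) = F t) :
    orbitSum μ RT F = orbitSum μ RS fun s => ∑ t ∈ fib s, F t := by
  -- A partition of unity over `RS`: whenever the transporter is nonzero, `s` and `p t` have equal
  -- orbit mass, so the weights sum to 1.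
  have h1 (t : T) : F t = ∑ s ∈ RS, (orbitMass μ RS s)⁻¹ • transporter μ (p t) s • F t := by
    have h : ∑ s ∈ RS, (orbitMass μ RS s)⁻¹ * transporter μ (p t) s = 1 := by
      rw [← mul_inv_cancel₀ (hS.orbitMass_pos hRS (p t)).ne', orbitMass, Finset.sum_mul]
      refine Finset.sum_congr rfl fun s _ => ?_
      rw [mul_comm]
      by_cases hg : ∃ g : G, g • p t = s
      · obtain ⟨g, rfl⟩ := hg
        rw [orbitMass_smul, orbitMass]
      · push Not at hg
        rw [transporter_eq_zero hg, zero_mul, zero_mul]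
    simp only [smul_smul]
    rw [← Finset.sum_smul, h, one_smul]
  -- The same partition over `RT` with the transporter reversed, by `transporter_comm`; invariance
  -- of `F` replaces `F t` by `F t'`.
  have h2 (t : T) : F t = ∑ t' ∈ RT, (orbitMass μ RT t')⁻¹ • transporter μ t' t • F t' := by
    have h : ∑ t' ∈ RT, (orbitMass μ RT t')⁻¹ * transporter μ t' t = 1 := by
      rw [← mul_inv_cancel₀ (hT.orbitMass_pos hRT t).ne', orbitMass, Finset.sum_mul]
      refine Finset.sum_congr rfl fun t' _ => ?_
      rw [mul_comm, transporter_comm t' t]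
      by_cases hg : ∃ g : G, g • t = t'
      · obtain ⟨g, rfl⟩ := hg
        rw [orbitMass_smul, orbitMass]
      · push Not at hg
        rw [transporter_eq_zero hg, zero_mul, zero_mul]
    have e (t' : T) : transporter μ t' t • F t' = transporter μ t' t • F t := by
      by_cases hg : ∃ g : G, g • t' = t
      · obtain ⟨g, rfl⟩ := hg
        rw [hF]
      · push Not at hg
        rw [transporter_eq_zero hg, zero_smul, zero_smul]
    simp only [e]
    simp only [smul_smul]
    rw [← Finset.sum_smul, h, one_smul]
  have h3 (s : S) : ∑ t ∈ fib s, F t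
      = ∑ t' ∈ RT, (orbitMass μ RT t')⁻¹ • transporter μ (p t') s • F t' := by
    rw [Finset.sum_congr rfl fun t _ => h2 t, Finset.sum_comm]
    refine Finset.sum_congr rfl fun t' _ => ?_
    rw [← Finset.smul_sum, hT.transporter_map hp hfib, Finset.sum_smul]
  -- Both sides become one double sum over `RS` and `RT`, with terms `transporter μ (p t) s • F t`
  -- divided by both orbit masses.
  unfold orbitSum
  simp only [h3]
  rw [Finset.sum_congr rfl fun t _ => congrArg _ (h1 t)]
  simp only [Finset.smul_sum]
  rw [Finset.sum_comm]
  refine Finset.sum_congr rfl fun s _ => Finset.sum_congr rfl fun t _ => ?_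
  rw [smul_comm]

end IsProperSmul

end OrbitSum

/-! ### The Poincaré inequality on a finite weighted graph -/

section SpectralGap

variable {W : Type*} [Fintype W]

theorem sum_mul_sum_sub_eq {a : W → W → ℝ} (ha : ∀ v w, a v w = a w v) (g h : W → ℝ) :
    ∑ v, g v * ∑ w, a v w * (h v - h w) =
      2⁻¹ * ∑ v, ∑ w, a v w * ((g v - g w) * (h v - h w)) := by
  have e : ∑ v, ∑ w, g w * (a v w * (h v - h w)) = -∑ v, ∑ w, g v * (a v w * (h v - h w)) := by
    rw [Finset.sum_comm, ← Finset.sum_neg_distrib]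
    refine Finset.sum_congr rfl fun v _ => ?_
    rw [← Finset.sum_neg_distrib]
    refine Finset.sum_congr rfl fun w _ => ?_
    rw [ha w v]; ring
  have e2 : ∑ v, ∑ w, a v w * ((g v - g w) * (h v - h w)) =
      ∑ v, ∑ w, g v * (a v w * (h v - h w)) - ∑ v, ∑ w, g w * (a v w * (h v - h w)) := by
    simp only [← Finset.sum_sub_distrib]
    refine Finset.sum_congr rfl fun v _ => Finset.sum_congr rfl fun w _ => ?_
    ring
  rw [e2, e]
  simp only [Finset.mul_sum]
  ring

/-- Expand `f` in eigenvectors of the Laplacian: the kernel consists of constants, to which `f` is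
orthogonal, and every other eigenvalue is at least κ. -/
theorem mul_sum_le_energy_of_sum_eq_zero {a : W → W → ℝ} (ha : ∀ v w, a v w = a w v)
    (ha0 : ∀ v w, 0 ≤ a v w) (hconn : ∀ h : W → ℝ, (∀ v w, 0 < a v w → h v = h w) →
      ∀ v w, h v = h w) {m : W → ℝ} (hm : ∀ v, 0 < m v) {Δ : Module.End ℝ (W → ℝ)}
    (hΔ : ∀ f v, Δ f v = ∑ w, a v w / m v * (f v - f w)) {κ : ℝ}
    (hκ : ∀ μ : ℝ, 0 < μ → Δ.HasEigenvalue μ → κ ≤ μ) {f : W → ℝ} (hf : ∑ v, m v * f v = 0) :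
    κ * ∑ v, m v * f v ^ 2 ≤ 2⁻¹ * ∑ v, ∑ w, a v w * (f v - f w) ^ 2 := by
  classical
  set q : W → ℝ := fun v => √(m v) with hq
  have q0 (v) : q v ≠ 0 := (Real.sqrt_pos.2 (hm v)).ne'
  have qq (v) : q v * q v = m v := Real.mul_self_sqrt (hm v).le
  let A : EuclideanSpace ℝ W →ₗ[ℝ] (W → ℝ) :=
    { toFun := fun x v => x v / q v
      map_add' := fun x y => by ext v; simp [add_div]
      map_smul' := fun c x => by ext v; simp [mul_div_assoc] }
  let B : (W → ℝ) →ₗ[ℝ] EuclideanSpace ℝ W :=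
    { toFun := fun f => WithLp.toLp 2 fun v => q v * f v
      map_add' := fun x y => by ext v; simp [mul_add]
      map_smul' := fun c x => by ext v; simp; ring }
  have hBA (x) : B (A x) = x := by ext v; simp [A, B, mul_div_cancel₀ _ (q0 v)]
  have hAB (f) : A (B f) = f := by ext v; simp [A, B, q0 v]
  -- Conjugation by √m turns `Δ`, self-adjoint for the m-weighted inner product, into a symmetric
  -- operator for the standard one.
  let T : EuclideanSpace ℝ W →ₗ[ℝ] EuclideanSpace ℝ W := B ∘ₗ Δ ∘ₗ A
  have hTinner (x y) : inner ℝ (T x) y =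
      2⁻¹ * ∑ v, ∑ w, a v w * ((A y v - A y w) * (A x v - A x w)) := by
    rw [← sum_mul_sum_sub_eq ha, PiLp.inner_apply]
    refine Finset.sum_congr rfl fun v _ => ?_
    simp only [T, LinearMap.comp_apply, RCLike.inner_apply, conj_trivial]
    change y v * (q v * Δ (A x) v) = y v / q v * _
    rw [hΔ, Finset.mul_sum, Finset.mul_sum, Finset.mul_sum]
    refine Finset.sum_congr rfl fun w _ => ?_
    rw [← qq v]
    field_simp [q0 v]
  have hT : T.IsSymmetric := by
    intro x y
    rw [hTinner, real_inner_comm, hTinner]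
    simp only [mul_comm (A y _ - _)]
  have hTx (x) : inner ℝ (T x) x = 2⁻¹ * ∑ v, ∑ w, a v w * (A x v - A x w) ^ 2 := by
    rw [hTinner]; simp only [pow_two]
  set b := hT.eigenvectorBasis rfl
  set l := hT.eigenvalues rfl
  have hTb (i) : T (b i) = l i • b i := hT.apply_eigenvectorBasis rfl i
  have hl (i) : l i = 2⁻¹ * ∑ v, ∑ w, a v w * (A (b i) v - A (b i) w) ^ 2 := by
    rw [← hTx, hTb, real_inner_smul_left, real_inner_self_eq_norm_sq]
    simp
  set x := B f
  have hx : A x = f := hAB f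
  have hsq : ∑ v, m v * f v ^ 2 = ∑ i, inner ℝ (b i) x ^ 2 := by
    have h := b.sum_sq_norm_inner_right x
    simp only [Real.norm_eq_abs, sq_abs] at h
    rw [h, EuclideanSpace.real_norm_sq_eq]
    refine Finset.sum_congr rfl fun v _ => ?_
    change _ = (q v * f v) ^ 2
    rw [mul_pow, pow_two (q v), qq]
  have hen : 2⁻¹ * ∑ v, ∑ w, a v w * (f v - f w) ^ 2 = ∑ i, l i * inner ℝ (b i) x ^ 2 := by
    rw [← hx, ← hTx, ← b.sum_inner_mul_inner]
    refine Finset.sum_congr rfl fun i _ => ?_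
    rw [hT, hTb, real_inner_smul_right, real_inner_comm]
    ring
  rw [hsq, hen, Finset.mul_sum]
  refine Finset.sum_le_sum fun i _ => ?_
  have hΔb : Δ (A (b i)) = l i • A (b i) := by
    have h := congrArg A (hTb i)
    rwa [map_smul, LinearMap.comp_apply, LinearMap.comp_apply, hAB] at h
  have hb0 : A (b i) ≠ 0 := by
    intro h
    have h' := hBA (b i)
    rw [h, map_zero] at h'
    exact b.orthonormal.ne_zero i h'.symm
  have hl0 : 0 ≤ l i := by
    rw [hl]
    exact mul_nonneg (by norm_num) (Finset.sum_nonneg fun v _ => Finset.sum_nonneg fun w _ =>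
      mul_nonneg (ha0 v w) (sq_nonneg _))
  rcases hl0.eq_or_lt with h0 | hpos
  · have hz : inner ℝ (b i) x = 0 := by
      have h1 : ∑ v, ∑ w, a v w * (A (b i) v - A (b i) w) ^ 2 = 0 := by
        have := hl i
        rw [← h0] at this
        linarith
      have hnn (v w) : 0 ≤ a v w * (A (b i) v - A (b i) w) ^ 2 :=
        mul_nonneg (ha0 v w) (sq_nonneg _)
      have h2 := hconn (A (b i)) fun v w hvw => by
        have h3 := (Finset.sum_eq_zero_iff_of_nonneg
          fun v _ => Finset.sum_nonneg fun w _ => hnn v w).1 h1 v (Finset.mem_univ v)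
        have h4 := (Finset.sum_eq_zero_iff_of_nonneg fun w _ => hnn v w).1 h3 w (Finset.mem_univ w)
        have h5 := (mul_eq_zero.1 h4).resolve_left hvw.ne'
        exact sub_eq_zero.1 (pow_eq_zero_iff two_ne_zero |>.1 h5)
      rw [PiLp.inner_apply]
      rcases isEmpty_or_nonempty W with hW | ⟨⟨v0⟩⟩
      · simp
      · rw [← mul_zero (A (b i) v0), ← hf, Finset.mul_sum]
        refine Finset.sum_congr rfl fun v _ => ?_
        rw [h2 v0 v, ← qq v]
        simp only [RCLike.inner_apply, conj_trivial]
        change q v * f v * b i v = b i v / q v * _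
        field_simp [q0 v]
    rw [hz]; simp
  · exact mul_le_mul_of_nonneg_right
      (hκ _ hpos (Module.End.hasEigenvalue_of_hasEigenvector
        ⟨Module.End.mem_eigenspace_iff.2 hΔb, hb0⟩)) (sq_nonneg _)

/-- Subtract the weighted mean, which leaves the energy unchanged. -/
theorem mul_variance_le_energy_real {a : W → W → ℝ} (ha : ∀ v w, a v w = a w v)
    (ha0 : ∀ v w, 0 ≤ a v w) (hconn : ∀ h : W → ℝ, (∀ v w, 0 < a v w → h v = h w) →
      ∀ v w, h v = h w) {m : W → ℝ} (hm : ∀ v, 0 < m v) {Δ : Module.End ℝ (W → ℝ)}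
    (hΔ : ∀ f v, Δ f v = ∑ w, a v w / m v * (f v - f w)) {κ : ℝ}
    (hκ : ∀ μ : ℝ, 0 < μ → Δ.HasEigenvalue μ → κ ≤ μ) (f : W → ℝ) :
    κ * (∑ v, m v * f v ^ 2 - (∑ v, m v)⁻¹ * (∑ v, m v * f v) ^ 2) ≤
      2⁻¹ * ∑ v, ∑ w, a v w * (f v - f w) ^ 2 := by
  rcases isEmpty_or_nonempty W with hW | hW
  · simp
  set M := ∑ v, m v with hM
  have hMpos : 0 < M := Finset.sum_pos (fun v _ => hm v) Finset.univ_nonempty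
  set c := M⁻¹ * ∑ v, m v * f v with hc
  have hMc : M * c = ∑ v, m v * f v := by
    rw [hc, ← mul_assoc, mul_inv_cancel₀ hMpos.ne', one_mul]
  have h0 : ∑ v, m v * (f v - c) = 0 := by
    simp only [mul_sub, Finset.sum_sub_distrib, ← Finset.sum_mul]
    rw [← hM, hMc, sub_self]
  have h := mul_sum_le_energy_of_sum_eq_zero ha ha0 hconn hm hΔ hκ h0
  simp only [sub_sub_sub_cancel_right] at h
  convert h using 2
  have e : ∑ v, m v * (f v - c) ^ 2 = ∑ v, m v * f v ^ 2 - 2 * c * (∑ v, m v * f v) + M * c ^ 2 := by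
    rw [hM, Finset.mul_sum, Finset.sum_mul, ← Finset.sum_sub_distrib, ← Finset.sum_add_distrib]
    exact Finset.sum_congr rfl fun v _ => by ring
  rw [e, ← hMc]
  field_simp
  ring

/-- The Poincaré inequality for vector valued functions on a connected weighted graph: the variance
is controlled by the energy and the smallest positive eigenvalue of the Laplacian. -/
theorem mul_variance_le_energy {a : W → W → ℝ} (ha : ∀ v w, a v w = a w v)
    (ha0 : ∀ v w, 0 ≤ a v w) (hconn : ∀ h : W → ℝ, (∀ v w, 0 < a v w → h v = h w) →
      ∀ v w, h v = h w) {m : W → ℝ} (hm : ∀ v, 0 < m v) {Δ : Module.End ℝ (W → ℝ)}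
    (hΔ : ∀ f v, Δ f v = ∑ w, a v w / m v * (f v - f w)) {κ : ℝ}
    (hκ : ∀ μ : ℝ, 0 < μ → Δ.HasEigenvalue μ → κ ≤ μ)
    {K : Type*} [NormedAddCommGroup K] [InnerProductSpace ℝ K] (f : W → K) :
    κ * (∑ v, m v * ‖f v‖ ^ 2 - (∑ v, m v)⁻¹ * ‖∑ v, m v • f v‖ ^ 2) ≤
      2⁻¹ * ∑ v, ∑ w, a v w * ‖f v - f w‖ ^ 2 := by
  -- Only finitely many values occur, so they span a finite-dimensional space. In an orthonormal
  -- basis both sides are sums over coordinates, which reduces to real functions.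
  let U := Submodule.span ℝ (Set.range f)
  have : FiniteDimensional ℝ U := FiniteDimensional.span_of_finite ℝ (Set.finite_range f)
  let b := stdOrthonormalBasis ℝ U
  let g : W → U := fun v => ⟨f v, Submodule.subset_span ⟨v, rfl⟩⟩
  have key (x : U) : ‖(x : K)‖ ^ 2 = ∑ i, inner ℝ (b i) x ^ 2 := by
    have h := b.sum_sq_norm_inner_right x
    simp only [Real.norm_eq_abs, sq_abs] at h
    rw [h]; rfl
  have h1 (v) : ‖f v‖ ^ 2 = ∑ i, inner ℝ (b i) (g v) ^ 2 := key (g v)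
  have h2 (v w) : ‖f v - f w‖ ^ 2 = ∑ i, (inner ℝ (b i) (g v) - inner ℝ (b i) (g w)) ^ 2 := by
    simp only [← inner_sub_right]
    exact key (g v - g w)
  have h3 : ‖∑ v, m v • f v‖ ^ 2 = ∑ i, (∑ v, m v * inner ℝ (b i) (g v)) ^ 2 := by
    have e : ∑ v, m v • f v = ((∑ v, m v • g v : U) : K) := by
      simp [g]
    rw [e, key]
    simp only [inner_sum, real_inner_smul_right]
  have h := Finset.sum_le_sum fun i (_ : i ∈ Finset.univ) =>
    mul_variance_le_energy_real ha ha0 hconn hm hΔ hκ fun v => inner ℝ (b i) (g v)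
  simp only [h1, h2, h3]
  rw [← Finset.mul_sum, ← Finset.mul_sum, Finset.sum_sub_distrib, ← Finset.mul_sum,
    Finset.sum_comm, Finset.sum_comm (s := Finset.univ) (t := Finset.univ)
      (f := fun i v => ∑ w, a v w * (inner ℝ (b i) (g v) - inner ℝ (b i) (g w)) ^ 2)] at h
  simp only [← Finset.mul_sum] at h
  refine h.trans_eq (congrArg _ (Finset.sum_congr rfl fun v _ => ?_))
  rw [Finset.sum_comm]
  simp only [← Finset.mul_sum]

end SpectralGap

/-! ### Compact stabilizers and properness of the action -/

namespace AbstractSimplicialComplex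

open Filter Topology

variable {V : Type u} {X : AbstractSimplicialComplex V}

theorem finite_setOf_exists_mem_mem (X : AbstractSimplicialComplex V) [X.IsLocallyFinite] (y : V) :
    {z | ∃ s ∈ X, y ∈ s ∧ z ∈ s}.Finite := by
  refine ((IsLocallyFinite.finite_star (X := X) y).biUnion (t := fun s => (s : Set V))
    fun s _ => s.finite_toSet).subset ?_
  rintro z ⟨s, hs, hy, hz⟩
  exact Set.mem_biUnion (x := s) ⟨hs, hy⟩ hz

/-- Induct along an edge path from `x`: automorphisms preserve edges, and each vertex has finitely
many neighbours. -/
theorem IsConnected.finite_stabilizer_orbit [X.IsLocallyFinite] (hX : X.IsConnected) (x y : V) :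
    {z | ∃ g : X.Aut, g.1 x = x ∧ g.1 y = z}.Finite := by
  have h := (SimpleGraph.reachable_iff_reflTransGen x y).1 (hX.preconnected x y)
  induction h with
  | refl =>
    refine (Set.finite_singleton x).subset ?_
    rintro z ⟨g, hg, rfl⟩
    exact hg
  | @tail y z _ hyz ih =>
    refine (ih.biUnion fun u _ => X.finite_setOf_exists_mem_mem u).subset ?_
    rintro _ ⟨g, hg, rfl⟩
    obtain ⟨-, s, hs, hy, hz⟩ := hyz
    refine Set.mem_biUnion (x := g.1 y) ⟨g, hg, rfl⟩ ⟨s.map g.1.toEmbedding, (g.2 s).2 hs, ?_, ?_⟩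
    · exact Finset.mem_map_of_mem _ hy
    · exact Finset.mem_map_of_mem _ hz

/-- Orbits of the stabilizer on vertices are finite, so along an ultrafilter the image of each
vertex is eventually constant. These constant values define the limit automorphism. -/
theorem isCompact_setOf_apply_eq_self [X.IsLocallyFinite] (hX : X.IsConnected) (x : V) :
    IsCompact {g : X.Aut | g.1 x = x} := by
  refine isCompact_iff_ultrafilter_le_nhds.2 fun U hU => ?_
  have hUx : ∀ᶠ g in (U : Filter X.Aut), g.1 x = x := le_principal_iff.1 hU
  have h1 (y : V) : ∃ z, ∀ᶠ g in (U : Filter X.Aut), g.1 y = z := by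
    obtain ⟨z, -, hz⟩ := (Ultrafilter.eventually_exists_mem_iff
      (hX.finite_stabilizer_orbit x y) (P := fun z (g : X.Aut) => g.1 y = z) (f := U)).1
        (hUx.mono fun g hg => ⟨g.1 y, ⟨g, hg, rfl⟩, rfl⟩)
    exact ⟨z, hz⟩
  -- Preimages must stabilize too; otherwise the pointwise limit need not be surjective.
  have h2 (y : V) : ∃ z, ∀ᶠ g in (U : Filter X.Aut), g.1 z = y := by
    obtain ⟨z, -, hz⟩ := (Ultrafilter.eventually_exists_mem_iff
      (hX.finite_stabilizer_orbit x y) (P := fun z (g : X.Aut) => g.1 z = y) (f := U)).1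
        (hUx.mono fun g hg => ⟨(g⁻¹).1 y, ⟨g⁻¹, Equiv.Perm.inv_eq_iff_eq.2 hg.symm, rfl⟩,
          Equiv.apply_symm_apply g.1 y⟩)
    exact ⟨z, hz⟩
  choose f hf using h1
  choose f' hf' using h2
  let e : Equiv.Perm V :=
    { toFun := f
      invFun := f'
      left_inv := fun y => by
        obtain ⟨g, hg1, hg2⟩ := ((hf y).and (hf' (f y))).exists
        exact g.1.injective (hg2.trans hg1.symm)
      right_inv := fun y => by
        obtain ⟨g, hg1, hg2⟩ := ((hf (f' y)).and (hf' y)).exists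
        exact hg1.symm.trans hg2 }
  have he : e ∈ X.Aut := by
    classical
    intro s
    -- On the finite set `s` the limit agrees with some actual automorphism, so it preserves
    -- simplices.
    obtain ⟨g, hg⟩ := ((eventually_all_finset s).2 fun y _ => hf y).exists
    have h : s.map e.toEmbedding = s.map g.1.toEmbedding := by
      rw [Finset.map_eq_image, Finset.map_eq_image]
      exact Finset.image_congr fun y hy => (hg y hy).symm
    rw [h]
    exact g.2 s
  refine ⟨⟨e, he⟩, ?_, ?_⟩
  · obtain ⟨g, hg1, hg2⟩ := ((hf x).and hUx).exists
    exact hg1.symm.trans hg2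
  · rw [nhds_iInf]
    refine le_iInf fun y => ?_
    let _ : TopologicalSpace V := ⊥
    have : DiscreteTopology V := ⟨rfl⟩
    rw [nhds_induced, nhds_discrete, ← map_le_iff_le_comap]
    exact tendsto_pure.2 (hf y)

theorem isCompact_vertexStabilizer [X.IsLocallyFinite] (hX : X.IsConnected) {G : Subgroup X.Aut}
    (hG : IsClosed (G : Set X.Aut)) (x : V) : IsCompact (vertexStabilizer G x) := by
  refine IsInducing.subtypeVal.isCompact_iff.2 ?_
  have e : Subtype.val '' vertexStabilizer G x = {g : X.Aut | g.1 x = x} ∩ G := by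
    ext g
    constructor
    · rintro ⟨g, hg, rfl⟩
      exact ⟨hg, g.2⟩
    · rintro ⟨h1, h2⟩
      exact ⟨⟨g, h2⟩, h1, rfl⟩
  refine Eq.subst (motive := IsCompact) e.symm ?_
  exact (isCompact_setOf_apply_eq_self hX x).inter_right hG

instance (G : Subgroup X.Aut) (k : ℕ) : MulAction G (X.OrderedSimplex k) where
  smul g σ := σ.translate g.1
  one_smul _ := rfl
  mul_smul _ _ _ := rfl

theorem IsCocompact.exists_finset {G : Subgroup X.Aut} (hG : IsCocompact G) (k : ℕ) :
    ∃ R : Finset (X.OrderedSimplex k), ∀ σ, ∃ g : G, g • σ ∈ R := by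
  obtain ⟨F, hF, h⟩ := hG
  set U : Set V := ⋃ s ∈ F, (s : Set V)
  have hU : U.Finite := hF.biUnion fun s _ => s.finite_toSet
  have hfin : {σ : X.OrderedSimplex k | ∀ i, σ.1 i ∈ U}.Finite :=
    Set.Finite.preimage (f := fun (σ : X.OrderedSimplex k) i => σ.1 i)
      (fun σ _ τ _ hστ => OrderedSimplex.ext fun i => congrFun hστ i)
      (Set.Finite.pi' fun _ => hU)
  refine ⟨hfin.toFinset, fun σ => ?_⟩
  obtain ⟨g, hg⟩ := h _ σ.2
  refine ⟨g, hfin.mem_toFinset.2 fun i => Set.mem_biUnion hg ?_⟩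
  rw [Finset.map_map]
  exact Finset.mem_coe.2 (Finset.mem_map_of_mem _ (Finset.mem_univ i))

theorem isOpen_setOf_smul_eq (G : Subgroup X.Aut) {k : ℕ} (σ τ : X.OrderedSimplex k) :
    IsOpen {g : G | g • σ = τ} := by
  have e : {g : G | g • σ = τ} = ⋂ i, Subtype.val ⁻¹' {g : X.Aut | g.1 (σ.1 i) = τ.1 i} := by
    ext g
    simp only [Set.mem_iInter]
    exact ⟨fun h i => by rw [← (h : g • σ = τ)]; rfl, fun h => OrderedSimplex.ext h⟩
  rw [e]
  exact isOpen_iInter_of_finite fun i =>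
    (X.isOpen_setOf_apply_eq _ _).preimage continuous_subtype_val

/-- Stabilizers of ordered simplices are open, hence of positive measure, and lie in a compact
vertex stabilizer, hence of finite measure. -/
theorem isProperSmul {G : Subgroup X.Aut} (hG : ∀ x, IsCompact (vertexStabilizer G x))
    [MeasurableSpace G] [BorelSpace G] (μ : MeasureTheory.Measure G) [μ.IsHaarMeasure] (k : ℕ) :
    IsProperSmul μ (X.OrderedSimplex k) where
  measurableSet σ τ := (isOpen_setOf_smul_eq G σ τ).measurableSet
  pos σ := (isOpen_setOf_smul_eq G σ σ).measure_pos μ ⟨1, one_smul _ _⟩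
  lt_top σ := by
    refine (MeasureTheory.measure_mono fun g hg => ?_).trans_lt (hG (σ.1 0)).measure_lt_top
    exact congrArg (fun τ : X.OrderedSimplex k => τ.1 0) hg

end AbstractSimplicialComplex

namespace AbstractSimplicialComplex

variable {V : Type u} {X : AbstractSimplicialComplex V}

/-! ### Weights -/

section Weight

theorem finite_setOf_top [X.IsLocallyFinite] (n : ℕ) {s : Finset V} (hs : s.Nonempty) :
    {t : Finset V | t ∈ X ∧ s ⊆ t ∧ t.card = n + 1}.Finite := by
  obtain ⟨v, hv⟩ := hs
  exact (IsLocallyFinite.finite_star (X := X) v).subset fun t ht => ⟨ht.1, ht.2.1 hv⟩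

theorem weight_pos [X.IsLocallyFinite] {n : ℕ} (hX : X.IsPure n) {s : Finset V} (hs : s ∈ X) :
    0 < X.weight n s := by
  obtain ⟨t, ht, hst, hc⟩ := hX.exists_top s hs
  exact (Set.ncard_pos (finite_setOf_top n (X.nonempty_of_mem hs))).2 ⟨t, ht, hst, hc⟩

theorem weight_eq_zero {n : ℕ} {s : Finset V} (hs : s.Nonempty) (h : s ∉ X) :
    X.weight n s = 0 := by
  have e : {t : Finset V | t ∈ X ∧ s ⊆ t ∧ t.card = n + 1} = ∅ := by
    ext t
    simp only [Set.mem_ofPred_eq, Set.mem_empty_iff_false, iff_false]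
    exact fun ht => h (X.mem_of_subset ht.1 ht.2.1 hs)
  rw [weight, e, Set.ncard_empty]

theorem weight_map (n : ℕ) (g : X.Aut) (s : Finset V) :
    X.weight n (s.map g.1.toEmbedding) = X.weight n s := by
  have e : {t : Finset V | t ∈ X ∧ s.map g.1.toEmbedding ⊆ t ∧ t.card = n + 1} =
      Finset.map g.1.toEmbedding '' {t : Finset V | t ∈ X ∧ s ⊆ t ∧ t.card = n + 1} := by
    ext t
    constructor
    · rintro ⟨h1, h2, h3⟩
      have ht : (t.map g.1.symm.toEmbedding).map g.1.toEmbedding = t := by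
        rw [Finset.map_map]; ext; simp
      refine ⟨t.map g.1.symm.toEmbedding, ⟨(g.2 _).1 (by rwa [ht]), ?_, ?_⟩, ht⟩
      · rwa [← ht, Finset.map_subset_map] at h2
      · rwa [Finset.card_map]
    · rintro ⟨t, ⟨h1, h2, h3⟩, rfl⟩
      exact ⟨(g.2 _).2 h1, Finset.map_subset_map.2 h2, by rwa [Finset.card_map]⟩
  rw [weight, weight, e, Set.ncard_image_of_injective _ (Finset.map_injective _)]

theorem mem_join {τ : X.faces} {η : Finset (X.LinkVertex τ)} {x : V} :
    x ∈ X.join τ η ↔ x ∈ τ.1 ∨ ∃ v ∈ η, v.1 = x := by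
  classical
  rw [join, Finset.mem_union]
  exact or_congr_right Finset.mem_map

theorem card_join (τ : X.faces) (η : Finset (X.LinkVertex τ)) :
    (X.join τ η).card = τ.1.card + η.card := by
  classical
  rw [join, Finset.card_union_of_disjoint]
  · exact congrArg _ (Finset.card_map _)
  refine Finset.disjoint_left.2 fun x hx hx' => ?_
  obtain ⟨v, -, rfl⟩ := Finset.mem_map.1 hx'
  exact v.2.1 hx

theorem join_subset_join {τ : X.faces} {η θ : Finset (X.LinkVertex τ)} :
    X.join τ η ⊆ X.join τ θ ↔ η ⊆ θ := by
  constructor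
  · intro h v hv
    rcases mem_join.1 (h (mem_join.2 (Or.inr ⟨v, hv, rfl⟩))) with h | ⟨w, hw, h⟩
    · exact absurd h v.2.1
    · rwa [← Subtype.ext h]
  · intro h x hx
    exact mem_join.2 ((mem_join.1 hx).imp_right fun ⟨v, hv, e⟩ => ⟨v, h hv, e⟩)

theorem join_injective (τ : X.faces) : Function.Injective (X.join τ) := fun _ _ h =>
  (join_subset_join.1 h.le).antisymm (join_subset_join.1 h.ge)

noncomputable instance [X.IsLocallyFinite] (τ : X.faces) : Fintype (X.LinkVertex τ) :=
  Fintype.ofFinite _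

theorem exists_join_eq [X.IsLocallyFinite] (τ : X.faces) {t : Finset V} (ht : t ∈ X)
    (h : τ.1 ⊆ t) : ∃ η, X.join τ η = t := by
  classical
  refine ⟨Finset.univ.filter fun v => v.1 ∈ t, ?_⟩
  ext x
  rw [mem_join]
  constructor
  · rintro (hx | ⟨v, hv, rfl⟩)
    · exact h hx
    · exact (Finset.mem_filter.1 hv).2
  · intro hx
    by_cases hxτ : x ∈ τ.1
    · exact Or.inl hxτ
    · exact Or.inr ⟨⟨x, hxτ, t, ht, hx, h⟩, Finset.mem_filter.2 ⟨Finset.mem_univ _, hx⟩, rfl⟩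

/-- Joining with `τ` matches top simplices of the link with n-simplices containing `τ`. The bound
`hτ` keeps the truncated difference `n - τ.1.card` equal to the true dimension. -/
theorem link_weight [X.IsLocallyFinite] {n : ℕ} (τ : X.faces) (hτ : τ.1.card ≤ n)
    (η : Finset (X.LinkVertex τ)) :
    (X.link τ).weight (n - τ.1.card) η = X.weight n (X.join τ η) := by
  have e : {t : Finset V | t ∈ X ∧ X.join τ η ⊆ t ∧ t.card = n + 1} =
      X.join τ '' {θ | θ ∈ X.link τ ∧ η ⊆ θ ∧ θ.card = n - τ.1.card + 1} := by
    ext t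
    constructor
    · rintro ⟨h1, h2, h3⟩
      obtain ⟨θ, rfl⟩ := exists_join_eq τ h1 (fun x hx => h2 (mem_join.2 (Or.inl hx)))
      rw [card_join] at h3
      have hc : θ.card = n - τ.1.card + 1 := by omega
      exact ⟨θ, ⟨⟨Finset.card_pos.1 (by omega), h1⟩, join_subset_join.1 h2, hc⟩, rfl⟩
    · rintro ⟨θ, ⟨h1, h2, h3⟩, rfl⟩
      exact ⟨h1.2, join_subset_join.2 h2, by rw [card_join]; omega⟩
  rw [weight, weight, e, Set.ncard_image_of_injective _ (join_injective τ)]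

/-- Count pairs of an n-simplex containing `τ` and one of its vertices outside `τ`. -/
theorem sum_weight_join_singleton [X.IsLocallyFinite] (n : ℕ) (τ : X.faces) :
    ∑ v, X.weight n (X.join τ {v}) = (n + 1 - τ.1.card) * X.weight n τ.1 := by
  classical
  set A := (finite_setOf_top (X := X) n (X.nonempty_of_mem τ.2)).toFinset
  have hA (t) : t ∈ A ↔ t ∈ X ∧ τ.1 ⊆ t ∧ t.card = n + 1 := Set.Finite.mem_toFinset _
  have h1 : X.weight n τ.1 = A.card := Set.ncard_eq_toFinset_card _ _
  have h2 (v : X.LinkVertex τ) : X.weight n (X.join τ {v}) = (A.filter fun t => v.1 ∈ t).card := by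
    rw [weight, ← Set.ncard_coe_finset]
    congr 1
    ext t
    simp only [Set.mem_ofPred_eq, Finset.coe_filter, hA]
    constructor
    · rintro ⟨h1, h2, h3⟩
      exact ⟨⟨h1, fun x hx => h2 (mem_join.2 (Or.inl hx)), h3⟩,
        h2 (mem_join.2 (Or.inr ⟨v, Finset.mem_singleton_self v, rfl⟩))⟩
    · rintro ⟨⟨h1, h2, h3⟩, h4⟩
      refine ⟨h1, fun x hx => ?_, h3⟩
      rcases mem_join.1 hx with hx | ⟨w, hw, rfl⟩
      · exact h2 hx
      · rwa [Finset.mem_singleton.1 hw]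
  have h3 (t) (ht : t ∈ A) :
      ((Finset.univ : Finset (X.LinkVertex τ)).filter fun v => v.1 ∈ t).card =
        n + 1 - τ.1.card := by
    obtain ⟨h1, h2, h3⟩ := (hA t).1 ht
    obtain ⟨η, rfl⟩ := exists_join_eq τ h1 h2
    have e : ((Finset.univ : Finset (X.LinkVertex τ)).filter fun v => v.1 ∈ X.join τ η) = η := by
      ext v
      rw [Finset.mem_filter, mem_join]
      constructor
      · rintro ⟨-, h | ⟨w, hw, h⟩⟩
        · exact absurd h v.2.1
        · rwa [← Subtype.ext h]
      · exact fun hv => ⟨Finset.mem_univ _, Or.inr ⟨v, hv, rfl⟩⟩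
    rw [e]
    rw [card_join] at h3
    omega
  simp only [h1, h2, Finset.card_filter]
  rw [Finset.sum_comm]
  simp only [← Finset.card_filter]
  rw [Finset.sum_congr rfl h3, Finset.sum_const, smul_eq_mul, mul_comm]

end Weight

/-! ### The local inequality in a link -/

section Link

-- Non-neighbours may be included in the sum: they have weight 0, and the diagonal term has a
-- vanishing difference.
open Classical in
theorem vertexLaplacian_link_apply [X.IsLocallyFinite] {n : ℕ} (τ : X.faces) (hτ : τ.1.card ≤ n)
    (f : X.LinkVertex τ → ℝ) (v : X.LinkVertex τ) :
    (X.link τ).vertexLaplacian (n - τ.1.card) f v =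
      ∑ w, (X.weight n (X.join τ {v, w}) : ℝ) / (X.weight n (X.join τ {v}) : ℝ) *
        (f v - f w) := by
  refine (Finset.sum_subset (Finset.filter_subset _ _) fun w _ hw => ?_).trans
    (Finset.sum_congr rfl fun w _ => ?_)
  · by_cases hvw : v = w
    · rw [hvw, sub_self, mul_zero]
    · have h : ({v, w} : Finset (X.LinkVertex τ)) ∉ X.link τ := fun h =>
        hw (Finset.mem_filter.2 ⟨Finset.mem_univ _, hvw, _, h, by simp, by simp⟩)
      rw [weight_eq_zero (by simp) h]
      simp
  · rw [link_weight τ hτ, link_weight τ hτ]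

open Classical in
/-- Garland's local inequality: the variance of a function on the vertices of a link is bounded by
its energy. -/
theorem mul_variance_le_of_le_kappa [X.IsLocallyFinite] {n : ℕ} (hX : X.IsPure n) (τ : X.faces)
    (hτ : τ.1.card ≤ n) (hconn : (X.link τ).IsConnected) {κ : ℝ} (hκ : κ ≤ X.kappa n τ)
    {K : Type*} [NormedAddCommGroup K] [InnerProductSpace ℝ K] (f : X.LinkVertex τ → K) :
    κ * (∑ v, (X.weight n (X.join τ {v}) : ℝ) * ‖f v‖ ^ 2 -
        (∑ v, (X.weight n (X.join τ {v}) : ℝ))⁻¹ *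
          ‖∑ v, (X.weight n (X.join τ {v}) : ℝ) • f v‖ ^ 2) ≤
      2⁻¹ * ∑ v, ∑ w, (X.weight n (X.join τ {v, w}) : ℝ) * ‖f v - f w‖ ^ 2 := by
  have hmem {η : Finset (X.LinkVertex τ)} (h : η ∈ X.link τ) : 0 < (X.weight n (X.join τ η) : ℝ) :=
    Nat.cast_pos.2 (weight_pos hX h.2)
  refine mul_variance_le_energy (fun v w => ?_) (fun v w => Nat.cast_nonneg _) (fun h hh v w => ?_)
    (fun v => hmem ((X.link τ).singleton_mem v)) (vertexLaplacian_link_apply τ hτ)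
    (fun μ hμ hev => ?_) f
  · rw [Finset.pair_comm]
  · have hvw := (SimpleGraph.reachable_iff_reflTransGen v w).1 (hconn.preconnected v w)
    induction hvw with
    | refl => rfl
    | @tail x y _ hxy ih =>
      obtain ⟨-, s, hs, hx, hy⟩ := hxy
      refine ih.trans (hh x y (hmem ((X.link τ).mem_of_subset hs ?_ (by simp))))
      exact Finset.insert_subset hx (Finset.singleton_subset_iff.2 hy)
  · exact hκ.trans (csInf_le ⟨0, fun _ h => h.1.le⟩ ⟨hμ, hev⟩)

end Link

end AbstractSimplicialComplex

/-! ### Cones over ordered simplices and their masses -/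

namespace AbstractSimplicialComplex

variable {V : Type u} {X : AbstractSimplicialComplex V}

namespace OrderedSimplex

variable {j : ℕ}

/-- The underlying simplex of an ordered simplex. -/
def verts (σ : X.OrderedSimplex j) : X.faces := ⟨Finset.univ.map σ.1, σ.2⟩

theorem card_verts (σ : X.OrderedSimplex j) : σ.verts.1.card = j + 1 := by
  simp [verts]

theorem mem_verts {σ : X.OrderedSimplex j} {x : V} : x ∈ σ.verts.1 ↔ ∃ i, σ.1 i = x := by
  simp [verts]

/-- The number of `n`-simplices that contain a given ordered simplex. -/
noncomputable def mass (n : ℕ) (σ : X.OrderedSimplex j) : ℝ := X.weight n σ.verts.1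

theorem mass_pos [X.IsLocallyFinite] {n : ℕ} (hX : X.IsPure n) (σ : X.OrderedSimplex j) :
    0 < σ.mass n :=
  Nat.cast_pos.2 (weight_pos hX σ.2)

theorem mass_smul (n : ℕ) {G : Subgroup X.Aut} (g : G) (σ : X.OrderedSimplex j) :
    (g • σ).mass n = σ.mass n := by
  have h := X.weight_map n g.1 σ.verts.1
  rw [verts, Finset.map_map] at h
  exact congrArg (Nat.cast : ℕ → ℝ) h

theorem mass_permute (n : ℕ) (σ : X.OrderedSimplex j) (π : Equiv.Perm (Fin (j + 1))) :
    (σ.permute π).mass n = σ.mass n := by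
  have h : (σ.permute π).verts.1 = σ.verts.1 := by
    ext x
    rw [mem_verts, mem_verts]
    exact (π.surjective.exists (p := fun i => σ.1 i = x)).symm
  rw [mass, mass, h]

theorem smul_face {G : Subgroup X.Aut} (g : G) (σ : X.OrderedSimplex (j + 1)) (i : Fin (j + 2)) :
    (g • σ).face i = g • σ.face i := rfl

/-- The ordered simplex `(v, v₀, …, v_j)`, where `v` is a vertex of the link of `(v₀, …, v_j)`. -/
def cone (σ : X.OrderedSimplex j) (v : X.LinkVertex σ.verts) : X.OrderedSimplex (j + 1) :=
  ⟨Fin.Embedding.cons σ.1 (a := v.1) fun h => v.2.1 (mem_verts.2 h), by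
    obtain ⟨s, hs, hv, hσ⟩ := v.2.2
    refine X.mem_of_subset hs ?_ Finset.univ_nonempty.map
    intro x hx
    obtain ⟨i, -, rfl⟩ := Finset.mem_map.1 hx
    induction i using Fin.cases with
    | zero => exact hv
    | succ i => exact hσ (mem_verts.2 ⟨i, rfl⟩)⟩

theorem cone_apply_zero (σ : X.OrderedSimplex j) (v : X.LinkVertex σ.verts) :
    (σ.cone v).1 0 = v.1 := rfl

theorem cone_apply_succ (σ : X.OrderedSimplex j) (v : X.LinkVertex σ.verts) (i : Fin (j + 1)) :
    (σ.cone v).1 i.succ = σ.1 i := rfl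

theorem cone_face_zero (σ : X.OrderedSimplex j) (v : X.LinkVertex σ.verts) :
    (σ.cone v).face 0 = σ := rfl

theorem cone_injective (σ : X.OrderedSimplex j) : Function.Injective σ.cone := fun _ _ h =>
  Subtype.ext (congrArg (fun τ : X.OrderedSimplex (j + 1) => τ.1 0) h)

theorem exists_cone_eq (σ : X.OrderedSimplex (j + 1)) : ∃ v, (σ.face 0).cone v = σ := by
  refine ⟨⟨σ.1 0, fun h => ?_, _, σ.2, Finset.mem_map_of_mem _ (Finset.mem_univ _), ?_⟩, ?_⟩
  · obtain ⟨i, hi⟩ := mem_verts.1 h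
    exact Fin.succ_ne_zero i (σ.1.injective hi)
  · intro x hx
    obtain ⟨i, rfl⟩ := mem_verts.1 hx
    exact Finset.mem_map_of_mem _ (Finset.mem_univ _)
  · ext i
    induction i using Fin.cases with
    | zero => rfl
    | succ i => rfl

/-- The ordered simplices `(v, v₀, …, v_j)` that extend `(v₀, …, v_j)`. -/
noncomputable def cofaces [X.IsLocallyFinite] (σ : X.OrderedSimplex j) :
    Finset (X.OrderedSimplex (j + 1)) :=
  Finset.univ.map ⟨σ.cone, σ.cone_injective⟩

/-- Thus `cofaces` are the finite fibres of `face 0`, the equivariant map to which Fubini is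
applied. -/
theorem mem_cofaces [X.IsLocallyFinite] {σ : X.OrderedSimplex j} {τ : X.OrderedSimplex (j + 1)} :
    τ ∈ σ.cofaces ↔ τ.face 0 = σ := by
  rw [cofaces, Finset.mem_map]
  constructor
  · rintro ⟨v, -, rfl⟩
    rfl
  · rintro rfl
    obtain ⟨v, hv⟩ := τ.exists_cone_eq
    exact ⟨v, Finset.mem_univ _, hv⟩

theorem sum_cofaces [X.IsLocallyFinite] {E : Type*} [AddCommMonoid E] (σ : X.OrderedSimplex j)
    (F : X.OrderedSimplex (j + 1) → E) : ∑ τ ∈ σ.cofaces, F τ = ∑ v, F (σ.cone v) :=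
  Finset.sum_map _ _ _

theorem sum_cofaces_smul [X.IsLocallyFinite] {E : Type*} [AddCommMonoid E] {G : Subgroup X.Aut}
    (g : G) (σ : X.OrderedSimplex j) (F : X.OrderedSimplex (j + 1) → E) :
    ∑ τ ∈ (g • σ).cofaces, F τ = ∑ τ ∈ σ.cofaces, F (g • τ) := by
  refine (Finset.sum_bij (fun τ _ => g • τ) (fun τ hτ => ?_) (fun _ _ _ _ h => ?_)
    (fun τ hτ => ⟨g⁻¹ • τ, ?_, ?_⟩) fun _ _ => rfl).symm
  · rw [mem_cofaces, smul_face, mem_cofaces.1 hτ]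
  · exact smul_left_cancel g h
  · rw [mem_cofaces, smul_face, mem_cofaces.1 hτ, inv_smul_smul]
  · rw [smul_inv_smul]

theorem permute_permute (σ : X.OrderedSimplex j) (π π' : Equiv.Perm (Fin (j + 1))) :
    (σ.permute π).permute π' = σ.permute (π * π') := rfl

theorem permute_one (σ : X.OrderedSimplex j) : σ.permute 1 = σ := rfl

theorem permute_decomposeFin_face_zero (σ : X.OrderedSimplex (j + 1))
    (π : Equiv.Perm (Fin (j + 1))) :
    (σ.permute (Equiv.Perm.decomposeFin.symm (0, π))).face 0 = (σ.face 0).permute π := by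
  ext i
  refine congrArg σ.1 ((Equiv.Perm.decomposeFin_symm_apply_succ π 0 i).trans ?_)
  rw [Equiv.swap_self]
  rfl

/-- Extend π to fix the new vertex 0; this does not change its sign. -/
theorem sum_cofaces_permute [X.IsLocallyFinite] {E : Type*} [AddCommMonoid E]
    (σ : X.OrderedSimplex j) (π : Equiv.Perm (Fin (j + 1))) (F : X.OrderedSimplex (j + 1) → E) :
    ∑ τ ∈ (σ.permute π).cofaces, F τ =
      ∑ τ ∈ σ.cofaces, F (τ.permute (Equiv.Perm.decomposeFin.symm (0, π))) := by
  set θ := Equiv.Perm.decomposeFin.symm (0, π) with hθ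
  have hinj : Function.Injective fun τ : X.OrderedSimplex (j + 1) => τ.permute θ := by
    intro τ τ' h
    have h' := congrArg (fun τ => τ.permute θ⁻¹) h
    simpa only [permute_permute, mul_inv_cancel, permute_one] using h'
  refine (Finset.sum_bij (fun τ _ => τ.permute θ) (fun τ hτ => ?_) (fun _ _ _ _ h => hinj h)
    (fun τ hτ => ⟨τ.permute θ⁻¹, ?_, ?_⟩) fun _ _ => rfl).symm
  · rw [mem_cofaces, hθ, permute_decomposeFin_face_zero, mem_cofaces.1 hτ]
  · have h : ((τ.permute θ⁻¹).permute θ).face 0 = ((τ.permute θ⁻¹).face 0).permute π :=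
      permute_decomposeFin_face_zero _ _
    rw [permute_permute, inv_mul_cancel, permute_one, mem_cofaces.1 hτ] at h
    have h' := congrArg (fun τ => τ.permute π⁻¹) h
    simp only [permute_permute, mul_inv_cancel, permute_one] at h'
    exact mem_cofaces.2 h'.symm
  · rw [permute_permute, inv_mul_cancel, permute_one]

theorem verts_cone (σ : X.OrderedSimplex j) (v : X.LinkVertex σ.verts) :
    (σ.cone v).verts.1 = X.join σ.verts {v} := by
  ext x
  rw [mem_verts, mem_join, Fin.exists_fin_succ, mem_verts, or_comm]
  simp only [cone_apply_zero, cone_apply_succ, Finset.mem_singleton, exists_eq_left]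

theorem mem_verts_cone {σ : X.OrderedSimplex j} {v : X.LinkVertex σ.verts} {x : V} :
    x ∈ (σ.cone v).verts.1 ↔ x ∈ σ.verts.1 ∨ v.1 = x := by
  rw [verts_cone, mem_join]
  simp only [Finset.mem_singleton, exists_eq_left]

theorem mass_cone (n : ℕ) (σ : X.OrderedSimplex j) (v : X.LinkVertex σ.verts) :
    (σ.cone v).mass n = X.weight n (X.join σ.verts {v}) := by
  rw [mass, verts_cone]

theorem sum_mass_cone [X.IsLocallyFinite] {n : ℕ} (hj : j ≤ n) (σ : X.OrderedSimplex j) :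
    ∑ v, (σ.cone v).mass n = ((n : ℝ) - j) * σ.mass n := by
  simp only [mass_cone]
  rw [← Nat.cast_sum, sum_weight_join_singleton, card_verts, Nat.add_sub_add_right, Nat.cast_mul,
    Nat.cast_sub hj]
  rfl

/-- A vertex of the link of a cone over `σ`, as a vertex of the link of `σ`. -/
def linkVertexOfCone (σ : X.OrderedSimplex j) (v : X.LinkVertex σ.verts)
    (u : X.LinkVertex (σ.cone v).verts) : X.LinkVertex σ.verts :=
  ⟨u.1, fun h => u.2.1 (mem_verts_cone.2 (Or.inl h)), by
    obtain ⟨s, hs, hu, hσ⟩ := u.2.2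
    exact ⟨s, hs, hu, fun x hx => hσ (mem_verts_cone.2 (Or.inl hx))⟩⟩

theorem cone_cone_face_one (σ : X.OrderedSimplex j) (v : X.LinkVertex σ.verts)
    (u : X.LinkVertex (σ.cone v).verts) :
    ((σ.cone v).cone u).face 1 = σ.cone (σ.linkVertexOfCone v u) := by
  ext i
  induction i using Fin.cases with
  | zero => rfl
  | succ i => rfl

open Classical in
theorem mass_cone_cone (n : ℕ) (σ : X.OrderedSimplex j) (v : X.LinkVertex σ.verts)
    (u : X.LinkVertex (σ.cone v).verts) :
    ((σ.cone v).cone u).mass n = X.weight n (X.join σ.verts {v, σ.linkVertexOfCone v u}) := by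
  rw [mass_cone]
  congr 2
  ext x
  refine mem_join.trans (Iff.trans ?_ mem_join.symm)
  simp only [mem_verts_cone, Finset.mem_singleton, Finset.mem_insert, exists_eq_left, or_assoc,
    exists_eq_or_imp]
  rfl

-- Vertices of the link of the cone are the neighbours of `v` in the link of `σ`. The remaining
-- terms vanish: non-neighbours have weight 0, and `w = v` is handled by `hf`.
open Classical in
theorem sum_mass_cone_cone [X.IsLocallyFinite] (n : ℕ) (σ : X.OrderedSimplex j)
    (v : X.LinkVertex σ.verts) {f : X.LinkVertex σ.verts → ℝ} (hf : f v = 0) :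
    ∑ u, ((σ.cone v).cone u).mass n * f (σ.linkVertexOfCone v u) =
      ∑ w, (X.weight n (X.join σ.verts {v, w}) : ℝ) * f w := by
  simp only [mass_cone_cone]
  refine Finset.sum_of_injOn (σ.linkVertexOfCone v)
    (fun a _ b _ h => Subtype.ext (congrArg (fun w : X.LinkVertex σ.verts => w.1) h))
    (by simp) (fun w _ hw => ?_) (fun u _ => rfl)
  by_cases hvw : w = v
  · rw [hvw, hf, mul_zero]
  · rw [weight_eq_zero, Nat.cast_zero, zero_mul]
    · exact (X.nonempty_of_mem σ.verts.2).mono fun x hx => mem_join.2 (Or.inl hx)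
    · intro h
      refine hw ⟨⟨w.1, fun h' => ?_, _, h, mem_join.2 (Or.inr ⟨w, by simp, rfl⟩), ?_⟩,
        Finset.mem_coe.2 (Finset.mem_univ _), rfl⟩
      · rcases mem_verts_cone.1 h' with h' | h'
        · exact w.2.1 h'
        · exact hvw (Subtype.ext h'.symm)
      · rw [verts_cone, join_subset_join]
        simp

end OrderedSimplex

/-! ### Sums over the orbits of ordered simplices -/

section SimplexSum

open MeasureTheory OrderedSimplex

variable {G : Subgroup X.Aut} [MeasurableSpace G]

/-- The sets `R j` meet all orbits of ordered simplices, and `G` acts properly on the latter. -/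
structure IsOrbitCover (μ : Measure G) (R : ∀ j, Finset (X.OrderedSimplex j)) : Prop where
  proper : ∀ j, IsProperSmul μ (X.OrderedSimplex j)
  exists_smul_mem : ∀ (j : ℕ) (σ : X.OrderedSimplex j), ∃ g : G, g • σ ∈ R j

variable [MeasurableMul G] {μ : Measure G} [μ.IsMulLeftInvariant] [μ.IsMulRightInvariant]
  {R : ∀ j, Finset (X.OrderedSimplex j)} {E : Type*} [AddCommGroup E] [Module ℝ E] {j : ℕ}

theorem IsOrbitCover.orbitSum_cone [X.IsLocallyFinite] (hR : IsOrbitCover μ R)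
    {F : X.OrderedSimplex (j + 1) → E}
    (hF : ∀ (g : G) σ, F (g • σ) = F σ) :
    orbitSum μ (R (j + 1)) F = orbitSum μ (R j) fun σ => ∑ v, F (σ.cone v) := by
  simp only [← sum_cofaces]
  exact IsProperSmul.orbitSum_eq_orbitSum_fiber (hR.proper j) (hR.proper (j + 1))
    (fun g σ => smul_face g σ 0) (fun _ _ => mem_cofaces) (hR.exists_smul_mem j)
    (hR.exists_smul_mem (j + 1)) hF

/-- Fubini for a bijection: the fibres of permuting by π⁻¹ are singletons. -/
theorem IsOrbitCover.orbitSum_permute (hR : IsOrbitCover μ R) {F : X.OrderedSimplex j → E}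
    (hF : ∀ (g : G) σ, F (g • σ) = F σ)
    (π : Equiv.Perm (Fin (j + 1))) :
    orbitSum μ (R j) (fun σ => F (σ.permute π)) = orbitSum μ (R j) F := by
  rw [IsProperSmul.orbitSum_eq_orbitSum_fiber (hR.proper j) (hR.proper j) (p := fun σ => σ.permute π⁻¹)
    (fun g σ => rfl) (fib := fun σ => {σ.permute π}) (fun σ τ => ?_) (hR.exists_smul_mem j) (hR.exists_smul_mem j) hF]
  · simp only [Finset.sum_singleton]
  · rw [Finset.mem_singleton]
    constructor
    · rintro rfl
      ext i
      exact congrArg σ.1 (π.apply_symm_apply i)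
    · rintro rfl
      ext i
      exact congrArg τ.1 (π.symm_apply_apply i).symm

end SimplexSum

end AbstractSimplicialComplex

/-! ### Codifferential, energy identity and Garland's inequality -/

namespace AbstractSimplicialComplex

section Garland

open MeasureTheory OrderedSimplex

variable {V : Type u} {X : AbstractSimplicialComplex V} {G : Subgroup X.Aut}
  {H : Type v} [NormedAddCommGroup H] [InnerProductSpace ℂ H] {ρ : G →* (H ≃ₗᵢ[ℂ] H)} {j : ℕ}

theorem cochains_apply_permute_face (φ : cochains ρ j) (σ : X.OrderedSimplex (j + 1))
    (π : Equiv.Perm (Fin (j + 2))) (i : Fin (j + 2)) :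
    φ.1 ((σ.permute π).face i) =
      ((-1 : ℂ) ^ (i : ℕ) * (-1) ^ (π i : ℕ) * ((Equiv.Perm.sign π : ℤ) : ℂ)) •
        φ.1 (σ.face (π i)) := by
  obtain ⟨π', h1, h2⟩ := exists_permute_face π i
  have e : (σ.permute π).face i = (σ.face (π i)).permute π' := by
    ext l
    exact congrArg σ.1 (h1 l)
  rw [e, φ.2.1, h2]
  push_cast
  rfl

theorem sign_mul_sign_cast {m : ℕ} (π : Equiv.Perm (Fin m)) :
    ((Equiv.Perm.sign π : ℤ) : ℂ) * ((Equiv.Perm.sign π : ℤ) : ℂ) = 1 := by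
  rcases Int.units_eq_one_or (Equiv.Perm.sign π) with h | h <;> simp [h]

/-- The adjoint of the differential, up to a positive factor. -/
noncomputable def codifferential [X.IsLocallyFinite] (n : ℕ) (ρ : G →* (H ≃ₗᵢ[ℂ] H)) (j : ℕ) :
    cochains ρ (j + 1) →ₗ[ℂ] cochains ρ j where
  toFun φ := ⟨fun τ => (τ.mass n : ℂ)⁻¹ • ∑ σ ∈ τ.cofaces, (σ.mass n : ℂ) • φ.1 σ, by
    constructor
    · intro π τ
      beta_reduce
      rw [sum_cofaces_permute, mass_permute, smul_comm _ (τ.mass n : ℂ)⁻¹, Finset.smul_sum (r := ((Equiv.Perm.sign π : ℤ) : ℂ))]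
      refine congrArg _ (Finset.sum_congr rfl fun σ _ => ?_)
      rw [mass_permute, φ.2.1, Equiv.Perm.decomposeFin.symm_sign, smul_comm]
      simp
    · intro g τ
      change (((g • τ).mass n : ℝ) : ℂ)⁻¹ • ∑ σ ∈ (g • τ).cofaces, (σ.mass n : ℂ) • φ.1 σ = _
      rw [sum_cofaces_smul, mass_smul, map_smul, map_sum]
      refine congrArg _ (Finset.sum_congr rfl fun σ _ => ?_)
      rw [mass_smul, map_smul, ← φ.2.2]
      rfl⟩
  map_add' φ ψ := by
    ext τ
    simp [Finset.sum_add_distrib]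
  map_smul' c φ := by
    ext τ
    change (τ.mass n : ℂ)⁻¹ • ∑ σ ∈ τ.cofaces, (σ.mass n : ℂ) • c • φ.1 σ =
      c • (τ.mass n : ℂ)⁻¹ • ∑ σ ∈ τ.cofaces, (σ.mass n : ℂ) • φ.1 σ
    rw [smul_comm c, Finset.smul_sum (r := c)]
    simp only [smul_comm c]

theorem codifferential_apply [X.IsLocallyFinite] (n : ℕ) (φ : cochains ρ (j + 1))
    (τ : X.OrderedSimplex j) : (codifferential n ρ j φ).1 τ =
      (τ.mass n : ℂ)⁻¹ • ∑ σ ∈ τ.cofaces, (σ.mass n : ℂ) • φ.1 σ := rfl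

theorem mass_smul_codifferential [X.IsLocallyFinite] {n : ℕ} (hX : X.IsPure n)
    (φ : cochains ρ (j + 1)) (τ : X.OrderedSimplex j) :
    (τ.mass n : ℂ) • (codifferential n ρ j φ).1 τ = ∑ σ ∈ τ.cofaces, (σ.mass n : ℂ) • φ.1 σ := by
  rw [codifferential_apply, smul_inv_smul₀]
  exact Complex.ofReal_ne_zero.2 (mass_pos hX τ).ne'

theorem cochainDifferential_apply (φ : cochains ρ j) (σ : X.OrderedSimplex (j + 1)) :
    (cochainDifferential ρ j φ).1 σ = ∑ i : Fin (j + 2), (-1 : ℂ) ^ (i : ℕ) • φ.1 (σ.face i) :=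
  rfl

theorem inner_cochains_smul {i : ℕ} (φ : cochains ρ j) (ψ : cochains ρ i) (g : G)
    (σ : X.OrderedSimplex j) (τ : X.OrderedSimplex i) :
    inner ℂ (φ.1 (g • σ)) (ψ.1 (g • τ)) = inner ℂ (φ.1 σ) (ψ.1 τ) := by
  have h1 : φ.1 (g • σ) = ρ g (φ.1 σ) := φ.2.2 g σ
  have h2 : ψ.1 (g • τ) = ρ g (ψ.1 τ) := ψ.2.2 g τ
  rw [h1, h2, LinearIsometryEquiv.inner_map_map]

theorem norm_cochains_smul (φ : cochains ρ j) (g : G) (σ : X.OrderedSimplex j) :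
    ‖φ.1 (g • σ)‖ = ‖φ.1 σ‖ := by
  have h1 : φ.1 (g • σ) = ρ g (φ.1 σ) := φ.2.2 g σ
  rw [h1, LinearIsometryEquiv.norm_map]

variable [MeasurableSpace G]

/-- The inner product of two cochains. -/
noncomputable def cochainInner (μ : Measure G) (R : ∀ j, Finset (X.OrderedSimplex j)) (n : ℕ)
    (φ ψ : cochains ρ j) : ℂ :=
  orbitSum μ (R j) fun σ => σ.mass n • inner ℂ (φ.1 σ) (ψ.1 σ)

/-- The square of the norm of a cochain. -/
noncomputable def cochainNormSq (μ : Measure G) (R : ∀ j, Finset (X.OrderedSimplex j)) (n : ℕ)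
    (φ : cochains ρ j) : ℝ :=
  orbitSum μ (R j) fun σ => σ.mass n * ‖φ.1 σ‖ ^ 2

theorem cochainInner_self (μ : Measure G) (R : ∀ j, Finset (X.OrderedSimplex j)) (n : ℕ)
    (φ : cochains ρ j) : cochainInner μ R n φ φ = cochainNormSq μ R n φ := by
  have h := orbitSum_map (μ := μ) (R j) Complex.ofRealCLM.toLinearMap
    fun σ => σ.mass n * ‖φ.1 σ‖ ^ 2
  refine Eq.trans (congrArg (orbitSum μ (R j)) (funext fun σ => ?_)) h
  simp [inner_self_eq_norm_sq_to_K]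

variable [MeasurableMul G] {μ : Measure G} [μ.IsMulLeftInvariant] [μ.IsMulRightInvariant]
  {R : ∀ j, Finset (X.OrderedSimplex j)} {n : ℕ}

/-- The factor j + 2 counts the faces of an ordered (j+1)-simplex: by alternation all contribute as
face 0 does, and Fubini along `face 0` produces the codifferential. -/
theorem IsOrbitCover.cochainInner_cochainDifferential [X.IsLocallyFinite] (hR : IsOrbitCover μ R)
    (hX : X.IsPure n) (ψ : cochains ρ j) (φ : cochains ρ (j + 1)) :
    cochainInner μ R n (cochainDifferential ρ j ψ) φ =
      (j + 2 : ℂ) * cochainInner μ R n ψ (codifferential n ρ j φ) := by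
  set F : X.OrderedSimplex (j + 1) → ℂ := fun σ =>
    σ.mass n • inner ℂ (ψ.1 (σ.face 0)) (φ.1 σ) with hF
  have hFinv (g : G) (σ) : F (g • σ) = F σ := by
    simp only [hF, mass_smul, smul_face, inner_cochains_smul]
  -- The transposition of 0 and i carries face i to face 0; its sign occurs in both arguments and
  -- cancels.
  have h1 (i : Fin (j + 2)) : orbitSum μ (R (j + 1)) (fun σ =>
      σ.mass n • ((-1 : ℂ) ^ (i : ℕ) * inner ℂ (ψ.1 (σ.face i)) (φ.1 σ))) =
        orbitSum μ (R (j + 1)) F := by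
    rw [← hR.orbitSum_permute hFinv (Equiv.swap 0 i)]
    refine congrArg _ (funext fun σ => ?_)
    simp only [hF, mass_permute, cochains_apply_permute_face, φ.2.1, Equiv.swap_apply_left,
      inner_smul_left, inner_smul_right]
    congr 1
    have h := sign_mul_sign_cast (Equiv.swap 0 i)
    simp only [Fin.val_zero, pow_zero, one_mul, map_mul, map_pow, map_neg, map_one, map_intCast]
    linear_combination (-((-1 : ℂ) ^ (i : ℕ) * inner ℂ (ψ.1 (σ.face i)) (φ.1 σ))) * h
  have h2 : cochainInner μ R n (cochainDifferential ρ j ψ) φ =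
      ∑ i : Fin (j + 2), orbitSum μ (R (j + 1)) (fun σ =>
        σ.mass n • ((-1 : ℂ) ^ (i : ℕ) * inner ℂ (ψ.1 (σ.face i)) (φ.1 σ))) := by
    rw [← orbitSum_sum]
    refine congrArg _ (funext fun σ => ?_)
    rw [cochainDifferential_apply, sum_inner, Finset.smul_sum]
    refine Finset.sum_congr rfl fun i _ => ?_
    rw [inner_smul_left]
    simp
  rw [h2, Finset.sum_congr rfl fun i _ => h1 i, Finset.sum_const, Finset.card_univ,
    Fintype.card_fin, nsmul_eq_mul, hR.orbitSum_cone hFinv]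
  push_cast
  congr 1
  refine congrArg _ (funext fun τ => ?_)
  have h3 := congrArg (inner ℂ (ψ.1 τ)) (mass_smul_codifferential hX φ τ)
  rw [inner_smul_right, inner_sum, sum_cofaces] at h3
  rw [Complex.real_smul, h3]
  refine Finset.sum_congr rfl fun v _ => ?_
  rw [hF, inner_smul_right]
  exact Complex.real_smul

theorem IsOrbitCover.cochainNormSq_eq_sum_cone [X.IsLocallyFinite] (hR : IsOrbitCover μ R)
    (φ : cochains ρ (j + 1)) : cochainNormSq μ R n φ =
      orbitSum μ (R j) fun τ => ∑ v, (τ.cone v).mass n * ‖φ.1 (τ.cone v)‖ ^ 2 :=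
  hR.orbitSum_cone fun g σ => by rw [mass_smul, norm_cochains_smul]

/-- Move face i to position 0, then use Fubini: the masses of the cones over τ add up to (n - j)
m(τ). -/
theorem IsOrbitCover.orbitSum_norm_face [X.IsLocallyFinite] (hR : IsOrbitCover μ R) (hj : j ≤ n)
    (φ : cochains ρ j) (i : Fin (j + 2)) :
    orbitSum μ (R (j + 1)) (fun σ => σ.mass n * ‖φ.1 (σ.face i)‖ ^ 2) =
      ((n : ℝ) - j) * cochainNormSq μ R n φ := by
  have hinv (g : G) (σ : X.OrderedSimplex (j + 1)) : (g • σ).mass n * ‖φ.1 ((g • σ).face 0)‖ ^ 2 =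
      σ.mass n * ‖φ.1 (σ.face 0)‖ ^ 2 := by
    rw [mass_smul, smul_face, norm_cochains_smul]
  trans orbitSum μ (R (j + 1)) (fun σ => σ.mass n * ‖φ.1 (σ.face 0)‖ ^ 2)
  · refine Eq.trans (congrArg _ (funext fun σ => ?_))
      (hR.orbitSum_permute hinv (Equiv.swap 0 i))
    rw [mass_permute, cochains_apply_permute_face, Equiv.swap_apply_left, norm_smul]
    have h : ‖((Equiv.Perm.sign (Equiv.swap 0 i) : ℤ) : ℂ)‖ = 1 := by
      rcases Int.units_eq_one_or (Equiv.Perm.sign (Equiv.swap 0 i)) with h | h <;> simp [h]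
    rw [norm_mul, h]
    simp
  · rw [hR.orbitSum_cone hinv, cochainNormSq, ← orbitSum_const_mul]
    refine congrArg _ (funext fun τ => ?_)
    simp only [cone_face_zero]
    rw [← Finset.sum_mul, sum_mass_cone hj, mul_assoc]

/-- The mixed term in the expansion of the norm of the differential of a cocycle. -/
theorem IsOrbitCover.orbitSum_inner_faces [X.IsLocallyFinite] (hR : IsOrbitCover μ R) (hj : j ≤ n)
    {φ : cochains ρ j} (hφ : cochainDifferential ρ j φ = 0) :
    (j + 1 : ℝ) * orbitSum μ (R (j + 1)) (fun σ =>
      σ.mass n * (inner ℂ (φ.1 (σ.face 1)) (φ.1 (σ.face 0))).re) =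
        ((n : ℝ) - j) * cochainNormSq μ R n φ := by
  set F : X.OrderedSimplex (j + 1) → ℝ := fun σ =>
    σ.mass n * (inner ℂ (φ.1 (σ.face 1)) (φ.1 (σ.face 0))).re with hF
  have hFinv (g : G) (σ) : F (g • σ) = F σ := by
    simp only [hF, mass_smul, smul_face, inner_cochains_smul]
  -- Swapping 1 and i + 1 fixes vertex 0, so every face other than face 0 gives the same cross term
  -- with it, up to sign.
  have h1 (i : Fin (j + 1)) : orbitSum μ (R (j + 1)) (fun σ =>
      σ.mass n * ((-1) ^ (i : ℕ) * (inner ℂ (φ.1 (σ.face i.succ)) (φ.1 (σ.face 0))).re)) =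
        orbitSum μ (R (j + 1)) F := by
    rw [← hR.orbitSum_permute hFinv (Equiv.swap 1 i.succ)]
    refine congrArg _ (funext fun σ => ?_)
    have h0 : Equiv.swap 1 i.succ 0 = 0 :=
      Equiv.swap_apply_of_ne_of_ne (by simp) (Fin.succ_ne_zero i).symm
    simp only [hF, mass_permute, cochains_apply_permute_face, Equiv.swap_apply_left, h0,
      inner_smul_left, inner_smul_right]
    congr 1
    have h := sign_mul_sign_cast (Equiv.swap 1 i.succ)
    have h' : (starRingEnd ℂ) ((-1) ^ ((1 : Fin (j + 2)) : ℕ) * (-1) ^ (i.succ : ℕ) *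
        ((Equiv.Perm.sign (Equiv.swap 1 i.succ) : ℤ) : ℂ)) *
        ((-1) ^ ((0 : Fin (j + 2)) : ℕ) * (-1) ^ ((0 : Fin (j + 2)) : ℕ) *
          ((Equiv.Perm.sign (Equiv.swap 1 i.succ) : ℤ) : ℂ)) = ((-1 : ℝ) ^ (i : ℕ) : ℝ) := by
      simp only [Fin.val_zero, Fin.val_one, Fin.val_succ, pow_zero, one_mul, map_mul, map_pow,
        map_neg, map_one, map_intCast, pow_succ]
      push_cast
      linear_combination ((-1 : ℂ) ^ (i : ℕ)) * h
    rw [mul_left_comm, ← mul_assoc, h', Complex.re_ofReal_mul]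
  -- Pair dφ = 0 with φ(σ_0). The term i = 0 is a square norm, and the other j + 1 terms are each
  -- minus the mixed term.
  have h2 : (0 : ℝ) = ∑ i : Fin (j + 2), orbitSum μ (R (j + 1)) (fun σ =>
      σ.mass n * ((-1) ^ (i : ℕ) * (inner ℂ (φ.1 (σ.face i)) (φ.1 (σ.face 0))).re)) := by
    rw [← orbitSum_sum]
    refine Eq.trans (Finset.sum_eq_zero fun σ _ => ?_).symm rfl
    beta_reduce
    rw [← Finset.mul_sum]
    have h3 : (inner ℂ ((cochainDifferential ρ j φ).1 σ) (φ.1 (σ.face 0))).re = 0 := by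
      rw [hφ]; simp
    rw [cochainDifferential_apply, sum_inner, Complex.re_sum] at h3
    rw [smul_eq_zero, mul_eq_zero]
    refine Or.inr (Or.inr (Eq.trans (Finset.sum_congr rfl fun i _ => ?_) h3))
    rw [inner_smul_left, ← Complex.re_ofReal_mul]
    simp
  rw [Fin.sum_univ_succ] at h2
  have h4 (i : Fin (j + 1)) : orbitSum μ (R (j + 1)) (fun σ => σ.mass n *
      ((-1) ^ (i.succ : ℕ) * (inner ℂ (φ.1 (σ.face i.succ)) (φ.1 (σ.face 0))).re)) =
        -orbitSum μ (R (j + 1)) F := by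
    rw [← h1 i]
    rw [← neg_one_mul (orbitSum _ _ _), ← orbitSum_const_mul]
    refine congrArg _ (funext fun σ => ?_)
    rw [Fin.val_succ, pow_succ]
    ring
  rw [Finset.sum_congr rfl fun i _ => h4 i, Finset.sum_const, Finset.card_univ, Fintype.card_fin,
    nsmul_eq_mul] at h2
  rw [← hR.orbitSum_norm_face hj φ 0]
  have h5 : orbitSum μ (R (j + 1)) (fun σ => σ.mass n * ((-1) ^ ((0 : Fin (j + 2)) : ℕ) *
      (inner ℂ (φ.1 (σ.face 0)) (φ.1 (σ.face 0))).re)) =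
        orbitSum μ (R (j + 1)) (fun σ => σ.mass n * ‖φ.1 (σ.face 0)‖ ^ 2) := by
    refine congrArg _ (funext fun σ => ?_)
    rw [inner_self_eq_norm_sq_to_K]
    simp [← Complex.ofReal_pow]
  rw [h5] at h2
  push_cast at h2
  linarith

-- Fubini twice turns the link energies into half the sum of m(σ)|φ(σ_0) - φ(σ_1)|² over
-- (j+2)-simplices. With k = j + 1, the squares give 2(n-k) and the cross term -2(n-k)/(k+1), which
-- after halving leaves k(n-k)/(k+1).
open Classical in
theorem IsOrbitCover.orbitSum_energy [X.IsLocallyFinite] (hR : IsOrbitCover μ R) (hj : j + 1 ≤ n)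
    {φ : cochains ρ (j + 1)} (hφ : cochainDifferential ρ (j + 1) φ = 0) :
    orbitSum μ (R j) (fun τ => 2⁻¹ * ∑ v, ∑ w, (X.weight n (X.join τ.verts {v, w}) : ℝ) *
      ‖φ.1 (τ.cone v) - φ.1 (τ.cone w)‖ ^ 2) =
        (j + 1 : ℝ) * ((n : ℝ) - (j + 1)) / (j + 2) * cochainNormSq μ R n φ := by
  set F : X.OrderedSimplex (j + 2) → ℝ := fun σ =>
    σ.mass n * ‖φ.1 (σ.face 0) - φ.1 (σ.face 1)‖ ^ 2 with hF
  have hFinv (g : G) (σ) : F (g • σ) = F σ := by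
    have h (i) : φ.1 (g • σ.face i) = ρ g (φ.1 (σ.face i)) := φ.2.2 g _
    simp only [hF, mass_smul, smul_face, h, ← map_sub, LinearIsometryEquiv.norm_map]
  have hFinv' (g : G) (σ : X.OrderedSimplex (j + 1)) :
      ∑ u, F ((g • σ).cone u) = ∑ u, F (σ.cone u) := by
    rw [← sum_cofaces, ← sum_cofaces, sum_cofaces_smul]
    simp only [hFinv]
  have h1 : orbitSum μ (R (j + 2)) F = orbitSum μ (R j) (fun τ =>
      ∑ v, ∑ w, (X.weight n (X.join τ.verts {v, w}) : ℝ) *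
        ‖φ.1 (τ.cone v) - φ.1 (τ.cone w)‖ ^ 2) := by
    rw [hR.orbitSum_cone hFinv, hR.orbitSum_cone hFinv']
    refine congrArg _ (funext fun τ => Finset.sum_congr rfl fun v _ => ?_)
    rw [← sum_mass_cone_cone n τ v (f := fun w => ‖φ.1 (τ.cone v) - φ.1 (τ.cone w)‖ ^ 2)
      (by simp)]
    simp only [hF, cone_face_zero, cone_cone_face_one]
  have h2 : orbitSum μ (R (j + 2)) F =
      orbitSum μ (R (j + 2)) (fun σ => σ.mass n * ‖φ.1 (σ.face 0)‖ ^ 2) +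
      (orbitSum μ (R (j + 2)) (fun σ => σ.mass n * ‖φ.1 (σ.face 1)‖ ^ 2) +
      -2 * orbitSum μ (R (j + 2)) (fun σ =>
        σ.mass n * (inner ℂ (φ.1 (σ.face 1)) (φ.1 (σ.face 0))).re)) := by
    rw [← orbitSum_const_mul, ← orbitSum_add, ← orbitSum_add]
    refine congrArg _ (funext fun σ => ?_)
    have h4 := norm_sub_sq (𝕜 := ℂ) (φ.1 (σ.face 0)) (φ.1 (σ.face 1))
    have h5 : RCLike.re (inner ℂ (φ.1 (σ.face 0)) (φ.1 (σ.face 1))) =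
        (inner ℂ (φ.1 (σ.face 1)) (φ.1 (σ.face 0))).re := inner_re_symm _ _
    simp only [hF, h4, h5]
    ring
  have h3 := hR.orbitSum_norm_face (n := n) hj φ 0
  have h4 := hR.orbitSum_norm_face (n := n) hj φ 1
  have h5 := hR.orbitSum_inner_faces (n := n) hj hφ
  rw [orbitSum_const_mul, ← h1, h2, h3, h4]
  push_cast at h5 ⊢
  have h7 : (j : ℝ) + 2 ≠ 0 := by positivity
  field_simp
  linear_combination (-2) * h5

/-- Garland's inequality for cocycles. -/
theorem IsOrbitCover.exists_mul_cochainNormSq_le [X.IsLocallyFinite] (hR : IsOrbitCover μ R)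
    (hX : X.IsPure n) (hj : j + 2 ≤ n)
    (hlink : ∀ τ : X.faces, τ.1.card = j + 1 → (X.link τ).IsConnected ∧
      (j + 1 : ℝ) * ((n : ℝ) - (j + 1)) / (j + 2) < X.kappa n τ) :
    ∃ ε : ℝ, 0 < ε ∧ ∀ φ : cochains ρ (j + 1), cochainDifferential ρ (j + 1) φ = 0 →
      ε * cochainNormSq μ R n φ ≤ cochainNormSq μ R n (codifferential n ρ j φ) := by
  classical
  set c : ℝ := (j + 1 : ℝ) * ((n : ℝ) - (j + 1)) / (j + 2) with hc
  have hnj : (j : ℝ) + 2 ≤ n := by exact_mod_cast hj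
  have hc0 : 0 < c := div_pos (mul_pos (by positivity) (by linarith)) (by positivity)
  -- Finitely many orbit representatives allow one κ strictly above c to serve all links.
  obtain ⟨κ, hκ, hcκ⟩ : ∃ κ, (∀ τ ∈ R j, κ ≤ X.kappa n τ.verts) ∧ c < κ := by
    have h1 : ∀ᶠ κ in nhdsWithin c (Set.Ioi c), ∀ τ ∈ R j, κ ≤ X.kappa n τ.verts :=
      (Filter.eventually_all_finset (R j)).2 fun τ _ =>
        ((eventually_lt_nhds (hlink τ.verts τ.card_verts).2).mono
          fun _ h => h.le).filter_mono nhdsWithin_le_nhds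
    exact (h1.and self_mem_nhdsWithin).exists
  have hκ0 : 0 < κ := hc0.trans hcκ
  have hnj' : (0 : ℝ) < n - j := by linarith
  -- This ε comes from solving `key`, κ(‖φ‖² - ‖δφ‖²/(n-j)) ≤ c‖φ‖², for ‖δφ‖².
  refine ⟨(κ - c) * (n - j) / κ, div_pos (mul_pos (by linarith) hnj') hκ0, fun φ hφ => ?_⟩
  have key : κ * (cochainNormSq μ R n φ - ((n : ℝ) - j)⁻¹ *
      cochainNormSq μ R n (codifferential n ρ j φ)) ≤ c * cochainNormSq μ R n φ := by
    rw [hc, ← hR.orbitSum_energy (by omega) hφ]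
    have e : κ * (cochainNormSq μ R n φ - ((n : ℝ) - j)⁻¹ *
        cochainNormSq μ R n (codifferential n ρ j φ)) = orbitSum μ (R j) (fun τ =>
          κ * (∑ v, (X.weight n (X.join τ.verts {v}) : ℝ) * ‖φ.1 (τ.cone v)‖ ^ 2 -
            (∑ v, (X.weight n (X.join τ.verts {v}) : ℝ))⁻¹ *
              ‖∑ v, (X.weight n (X.join τ.verts {v}) : ℝ) • φ.1 (τ.cone v)‖ ^ 2)) := by
      -- The squared-mean term of the variance: the weighted sum of values is m(τ) δφ(τ), and the
      -- total weight is (n - j) m(τ).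
      have h1 (τ : X.OrderedSimplex j) : (∑ v, (X.weight n (X.join τ.verts {v}) : ℝ))⁻¹ *
          ‖∑ v, (X.weight n (X.join τ.verts {v}) : ℝ) • φ.1 (τ.cone v)‖ ^ 2 =
            ((n : ℝ) - j)⁻¹ * (τ.mass n * ‖(codifferential n ρ j φ).1 τ‖ ^ 2) := by
        simp only [← mass_cone]
        have h2 : ∑ v, (τ.cone v).mass n • φ.1 (τ.cone v) =
            (τ.mass n : ℂ) • (codifferential n ρ j φ).1 τ := by
          rw [mass_smul_codifferential hX, sum_cofaces]
          simp only [Complex.coe_smul]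
        have h3 := mass_pos hX τ
        rw [sum_mass_cone (by omega), h2, norm_smul, Complex.norm_real, Real.norm_of_nonneg h3.le]
        field_simp
      simp only [h1]
      rw [orbitSum_const_mul, orbitSum_sub, orbitSum_const_mul, hR.cochainNormSq_eq_sum_cone φ]
      simp only [mass_cone]
      rfl
    rw [e]
    refine orbitSum_mono fun τ hτ => ?_
    let _ : InnerProductSpace ℝ H := InnerProductSpace.rclikeToReal ℂ H
    have h4 := mul_variance_le_of_le_kappa hX τ.verts (by rw [card_verts]; omega)
      (hlink τ.verts τ.card_verts).1 (hκ τ hτ) (K := H) (fun v => φ.1 (τ.cone v))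
    exact h4
  rw [div_mul_eq_mul_div, div_le_iff₀ hκ0]
  have h2 : ((n : ℝ) - j) * (((n : ℝ) - j)⁻¹ * cochainNormSq μ R n (codifferential n ρ j φ)) =
      cochainNormSq μ R n (codifferential n ρ j φ) := mul_inv_cancel_left₀ hnj'.ne' _
  have h3 := mul_le_mul_of_nonneg_left key hnj'.le
  linear_combination h3 + κ * h2

end Garland

end AbstractSimplicialComplex

/-- A symmetric coercive operator on a Hilbert space is surjective. The Hilbert space is given by
an inner product on a complex vector space. -/
theorem InnerProductSpace.Core.surjective_of_coercive {Z : Type*} [AddCommGroup Z] [Module ℂ Z]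
    (core : InnerProductSpace.Core ℂ Z)
    (hcomplete : ∀ u : ℕ → Z,
      (∀ ε > 0, ∃ N, ∀ m ≥ N, ∀ n ≥ N, (core.inner (u m - u n) (u m - u n)).re < ε) →
        ∃ z, ∀ ε > 0, ∃ N, ∀ n ≥ N, (core.inner (u n - z) (u n - z)).re < ε)
    (S : Z →ₗ[ℂ] Z) (hS : ∀ x y, core.inner (S x) y = core.inner x (S y)) {c : ℝ} (hc : 0 < c)
    (hcoer : ∀ x, c * (core.inner x x).re ≤ (core.inner (S x) x).re) :
    Function.Surjective S := by
  let _ : NormedAddCommGroup Z := core.toNormedAddCommGroup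
  let _ : InnerProductSpace ℂ Z := InnerProductSpace.ofCore core.toCore
  have hnorm (x : Z) : (core.inner x x).re = ‖x‖ ^ 2 := (norm_sq_eq_re_inner (𝕜 := ℂ) x).symm
  simp only [hnorm] at hcomplete hcoer
  have hsq {a b : ℝ} (ha : 0 ≤ a) (hb : 0 < b) : a ^ 2 < b ^ 2 ↔ a < b :=
    sq_lt_sq₀ ha hb.le
  have : CompleteSpace Z := by
    refine Metric.complete_of_cauchySeq_tendsto fun u hu => ?_
    obtain ⟨z, hz⟩ := hcomplete u fun ε hε => by
      obtain ⟨N, hN⟩ := Metric.cauchySeq_iff.1 hu (√ε) (Real.sqrt_pos.2 hε)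
      refine ⟨N, fun m hm n hn => ?_⟩
      rw [← Real.sq_sqrt hε.le, hsq (norm_nonneg _) (Real.sqrt_pos.2 hε), ← dist_eq_norm]
      exact hN m hm n hn
    refine ⟨z, Metric.tendsto_atTop.2 fun ε hε => ?_⟩
    obtain ⟨N, hN⟩ := hz (ε ^ 2) (by positivity)
    refine ⟨N, fun n hn => ?_⟩
    rw [dist_eq_norm, ← hsq (norm_nonneg _) hε]
    exact hN n hn
  have hsymm : S.IsSymmetric := hS
  have hbound (x : Z) : c * ‖x‖ ≤ ‖S x‖ := by
    rcases (norm_nonneg x).eq_or_lt with h | h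
    · rw [← h, mul_zero]; exact norm_nonneg _
    · have h1 : c * ‖x‖ ^ 2 ≤ ‖S x‖ * ‖x‖ := (hcoer x).trans (re_inner_le_norm (𝕜 := ℂ) (S x) x)
      nlinarith
  have hanti : AntilipschitzWith c⁻¹.toNNReal S := by
    refine AddMonoidHomClass.antilipschitz_of_bound S fun x => ?_
    rw [Real.coe_toNNReal _ (inv_nonneg.2 hc.le)]
    exact (le_inv_mul_iff₀ hc).2 (hbound x)
  -- Hellinger–Toeplitz: a symmetric operator defined on all of a Hilbert space is bounded.
  have hcont : UniformContinuous S :=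
    (⟨S, hsymm.continuous⟩ : Z →L[ℂ] Z).uniformContinuous
  have hclosed : IsClosed (LinearMap.range S : Set Z) := by
    rw [LinearMap.coe_range]
    exact hanti.isClosed_range hcont
  have : CompleteSpace (LinearMap.range S) := hclosed.completeSpace_coe
  -- The range is closed, so it suffices that its orthogonal complement vanish: y orthogonal to `S
  -- y` contradicts coercivity unless y = 0.
  rw [← LinearMap.range_eq_top, ← Submodule.orthogonal_eq_bot_iff, Submodule.eq_bot_iff]
  intro y hy
  have h0 : (core.inner (S y) y).re = 0 := by
    have h := (Submodule.mem_orthogonal _ _).1 hy (S y) ⟨y, rfl⟩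
    exact congrArg Complex.re h
  have h1 := hcoer y
  rw [h0] at h1
  have h2 : ‖y‖ ^ 2 ≤ 0 := nonpos_of_mul_nonpos_right h1 hc
  exact norm_eq_zero.1 (pow_eq_zero_iff two_ne_zero |>.1 (h2.antisymm (sq_nonneg _)))

/-! ### The Hilbert space of cocycles and exactness -/

namespace AbstractSimplicialComplex

open MeasureTheory OrderedSimplex Filter Topology

variable {V : Type u} {X : AbstractSimplicialComplex V} {G : Subgroup X.Aut}
  {H : Type v} [NormedAddCommGroup H] [InnerProductSpace ℂ H] {ρ : G →* (H ≃ₗᵢ[ℂ] H)} {j : ℕ}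

section

variable [MeasurableSpace G] {μ : Measure G} {R : ∀ j, Finset (X.OrderedSimplex j)} {n : ℕ}

theorem cochainInner_conj_symm (φ ψ : cochains ρ j) :
    (starRingEnd ℂ) (cochainInner μ R n ψ φ) = cochainInner μ R n φ ψ := by
  refine (orbitSum_map (μ := μ) (R j) Complex.conjCLE.toLinearEquiv.toLinearMap _).symm.trans ?_
  refine congrArg (orbitSum μ (R j)) (funext fun σ => ?_)
  change (starRingEnd ℂ) (σ.mass n • inner ℂ (ψ.1 σ) (φ.1 σ)) = _
  rw [Complex.real_smul, map_mul, inner_conj_symm, Complex.conj_ofReal, Complex.real_smul]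

theorem cochainInner_add_left (φ φ' ψ : cochains ρ j) :
    cochainInner μ R n (φ + φ') ψ = cochainInner μ R n φ ψ + cochainInner μ R n φ' ψ := by
  refine Eq.trans (congrArg (orbitSum μ (R j)) (funext fun σ => ?_)) (orbitSum_add (R j) _ _)
  rw [← smul_add, ← inner_add_left]
  rfl

theorem cochainInner_smul_left (φ ψ : cochains ρ j) (c : ℂ) :
    cochainInner μ R n (c • φ) ψ = (starRingEnd ℂ) c * cochainInner μ R n φ ψ := by
  refine Eq.trans (congrArg (orbitSum μ (R j)) (funext fun σ => ?_))
    (orbitSum_map (μ := μ) (R j) (LinearMap.mulLeft ℝ ((starRingEnd ℂ) c)) _)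
  change σ.mass n • inner ℂ (c • φ.1 σ) (ψ.1 σ) =
    (starRingEnd ℂ) c * (σ.mass n • inner ℂ (φ.1 σ) (ψ.1 σ))
  rw [inner_smul_left, mul_smul_comm]

theorem cochainInner_self_re (φ : cochains ρ j) :
    (cochainInner μ R n φ φ).re = cochainNormSq μ R n φ := by
  rw [cochainInner_self, Complex.ofReal_re]

theorem cochainNormSq_nonneg (φ : cochains ρ j) : 0 ≤ cochainNormSq μ R n φ :=
  Finset.sum_nonneg fun _ _ => mul_nonneg
    (inv_nonneg.2 (Finset.sum_nonneg fun _ _ => transporter_nonneg _ _))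
    (mul_nonneg (Nat.cast_nonneg _) (sq_nonneg _))

variable [MeasurableMul G] [μ.IsMulRightInvariant]

/-- Unitarity moves σ to a representative in `R j`, whose term is bounded by the whole sum.
Evaluation at σ is thus bounded, which gives both definiteness and completeness. -/
theorem IsOrbitCover.exists_mul_norm_sq_le [X.IsLocallyFinite] (hR : IsOrbitCover μ R)
    (hX : X.IsPure n) (σ : X.OrderedSimplex j) : ∃ c : ℝ, 0 < c ∧
      ∀ φ : cochains ρ j, c * ‖φ.1 σ‖ ^ 2 ≤ cochainNormSq μ R n φ := by
  obtain ⟨g, hg⟩ := hR.exists_smul_mem j σ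
  refine ⟨(orbitMass μ (R j) (g • σ))⁻¹ * (g • σ).mass n, mul_pos (inv_pos.2
    ((hR.proper j).orbitMass_pos (hR.exists_smul_mem j) _)) (mass_pos hX _), fun φ => ?_⟩
  rw [← norm_cochains_smul φ g σ, mul_assoc]
  exact Finset.single_le_sum (f := fun σ : X.OrderedSimplex j =>
    (orbitMass μ (R j) σ)⁻¹ • (σ.mass n * ‖φ.1 σ‖ ^ 2)) (fun σ _ => mul_nonneg
      (inv_nonneg.2 (Finset.sum_nonneg fun _ _ => transporter_nonneg _ _))
      (mul_nonneg (Nat.cast_nonneg _) (sq_nonneg _))) hg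

theorem IsOrbitCover.eq_zero_of_cochainNormSq_eq_zero [X.IsLocallyFinite] (hR : IsOrbitCover μ R)
    (hX : X.IsPure n) {φ : cochains ρ j} (h : cochainNormSq μ R n φ = 0) : φ = 0 := by
  ext σ
  obtain ⟨c, hc, hle⟩ := hR.exists_mul_norm_sq_le (ρ := ρ) hX σ
  have h1 := hle φ
  rw [h] at h1
  have h2 : ‖φ.1 σ‖ ^ 2 ≤ 0 := nonpos_of_mul_nonpos_right h1 hc
  exact norm_eq_zero.1 (pow_eq_zero_iff two_ne_zero |>.1 (h2.antisymm (sq_nonneg _)))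

/-- The space of cocycles is complete. -/
theorem IsOrbitCover.exists_limit_cocycle [CompleteSpace H] [X.IsLocallyFinite]
    (hR : IsOrbitCover μ R) (hX : X.IsPure n) {u : ℕ → cochains ρ j}
    (hu : ∀ i, cochainDifferential ρ j (u i) = 0)
    (hc : ∀ ε > 0, ∃ N, ∀ l ≥ N, ∀ m ≥ N, cochainNormSq μ R n (u l - u m) < ε) :
    ∃ φ : cochains ρ j, cochainDifferential ρ j φ = 0 ∧
      ∀ ε > 0, ∃ N, ∀ m ≥ N, cochainNormSq μ R n (u m - φ) < ε := by
  have hcauchy (σ : X.OrderedSimplex j) : CauchySeq fun i => (u i).1 σ := by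
    obtain ⟨c, hc0, hle⟩ := hR.exists_mul_norm_sq_le (ρ := ρ) hX σ
    refine Metric.cauchySeq_iff.2 fun ε hε => ?_
    obtain ⟨N, hN⟩ := hc (c * ε ^ 2) (by positivity)
    refine ⟨N, fun l hl m hm => ?_⟩
    have h := (hle (u l - u m)).trans_lt (hN l hl m hm)
    rw [dist_eq_norm]
    exact lt_of_pow_lt_pow_left₀ 2 hε.le (lt_of_mul_lt_mul_left h hc0.le)
  -- Alternation, equivariance and closedness survive pointwise limits, and the norm involves only
  -- finitely many simplices, so pointwise convergence implies norm convergence.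
  choose Φ hΦ using fun σ => cauchySeq_tendsto_of_complete (hcauchy σ)
  let φ : cochains ρ j := ⟨Φ, by
    constructor
    · intro π σ
      refine tendsto_nhds_unique (hΦ (σ.permute π)) ?_
      simp only [(u _).2.1 π σ]
      exact (hΦ σ).const_smul _
    · intro g σ
      refine tendsto_nhds_unique (hΦ (σ.translate g.1)) ?_
      simp only [(u _).2.2 g σ]
      exact ((ρ g).continuous.tendsto _).comp (hΦ σ)⟩
  refine ⟨φ, ?_, ?_⟩
  · ext σ
    refine tendsto_nhds_unique (f := fun i => (cochainDifferential ρ j (u i)).1 σ) (l := atTop) ?_ ?_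
    · simp only [cochainDifferential_apply]
      exact tendsto_finsetSum _ fun i _ => (hΦ _).const_smul _
    · simp only [hu]
      exact tendsto_const_nhds
  · have h : Tendsto (fun m => cochainNormSq μ R n (u m - φ)) atTop (𝓝 0) := by
      have h1 (σ : X.OrderedSimplex j) : Tendsto (fun m => (orbitMass μ (R j) σ)⁻¹ •
          (σ.mass n * ‖(u m).1 σ - Φ σ‖ ^ 2)) atTop (𝓝 0) := by
        have h2 := ((((hΦ σ).sub_const (Φ σ)).norm.pow 2).const_mul (σ.mass n)).const_smul
          (orbitMass μ (R j) σ)⁻¹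
        simpa using h2
      have h3 := tendsto_finsetSum (R j) fun σ _ => h1 σ
      rw [Finset.sum_const_zero] at h3
      exact h3
    intro ε hε
    exact eventually_atTop.1 (h.eventually (gt_mem_nhds hε))

/-- The inner product on the space of cocycles. -/
@[reducible]
noncomputable def IsOrbitCover.cocycleCore [X.IsLocallyFinite] (hR : IsOrbitCover μ R)
    (hX : X.IsPure n) (ρ : G →* (H ≃ₗᵢ[ℂ] H)) (j : ℕ) :
    InnerProductSpace.Core ℂ (LinearMap.ker (cochainDifferential ρ j)) where
  inner φ ψ := cochainInner μ R n φ.1 ψ.1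
  conj_inner_symm φ ψ := cochainInner_conj_symm φ.1 ψ.1
  re_inner_nonneg φ := (cochainNormSq_nonneg φ.1).trans_eq (cochainInner_self_re φ.1).symm
  add_left φ φ' ψ := cochainInner_add_left φ.1 φ'.1 ψ.1
  smul_left φ ψ c := cochainInner_smul_left φ.1 ψ.1 c
  definite φ h := by
    refine Subtype.ext (hR.eq_zero_of_cochainNormSq_eq_zero hX ?_)
    rw [← cochainInner_self_re]
    exact congrArg Complex.re h

/-- On cocycles, S = dδ satisfies ⟨Sφ, ψ⟩ = (j+2)⟨δφ, δψ⟩, so it is symmetric, and `hgap` makes it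
coercive with constant (j+2)ε. If S z = φ, then δz is the required primitive. -/
theorem IsOrbitCover.exists_cochainDifferential_eq [μ.IsMulLeftInvariant] [CompleteSpace H] [X.IsLocallyFinite]
    (hR : IsOrbitCover μ R) (hX : X.IsPure n) {ε : ℝ} (hε : 0 < ε)
    (hgap : ∀ φ : cochains ρ (j + 1), cochainDifferential ρ (j + 1) φ = 0 →
      ε * cochainNormSq μ R n φ ≤ cochainNormSq μ R n (codifferential n ρ j φ))
    {φ : cochains ρ (j + 1)} (hφ : cochainDifferential ρ (j + 1) φ = 0) :
    ∃ ψ, cochainDifferential ρ j ψ = φ := by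
  have hcast : ((j : ℂ) + 2) = ((j + 2 : ℝ) : ℂ) := by push_cast; rfl
  let core := hR.cocycleCore hX ρ (j + 1)
  let S : LinearMap.ker (cochainDifferential ρ (j + 1)) →ₗ[ℂ]
      LinearMap.ker (cochainDifferential ρ (j + 1)) :=
    ((cochainDifferential ρ j ∘ₗ codifferential n ρ j) ∘ₗ Submodule.subtype _).codRestrict _
      fun φ => cochainDifferential_comp ρ j _
  have hS (φ ψ) : core.inner (S φ) ψ = (j + 2 : ℂ) *
      cochainInner μ R n (codifferential n ρ j φ.1) (codifferential n ρ j ψ.1) :=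
    hR.cochainInner_cochainDifferential hX _ _
  obtain ⟨z, hz⟩ := core.surjective_of_coercive (S := S) (c := (j + 2) * ε)
    (fun u hu => by
      obtain ⟨φ, h1, h2⟩ := hR.exists_limit_cocycle hX (u := fun i => (u i).1)
        (fun i => (u i).2) fun ε hε => by
          obtain ⟨N, hN⟩ := hu ε hε
          refine ⟨N, fun l hl m hm => ?_⟩
          rw [← cochainInner_self_re]
          exact hN l hl m hm
      refine ⟨⟨φ, h1⟩, fun ε hε => ?_⟩
      obtain ⟨N, hN⟩ := h2 ε hε
      refine ⟨N, fun m hm => ?_⟩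
      have h3 := hN m hm
      rw [← cochainInner_self_re] at h3
      exact h3)
    (fun φ ψ => by
      rw [← core.conj_inner_symm φ, hS, hS, map_mul, cochainInner_conj_symm, hcast,
        Complex.conj_ofReal])
    (by positivity)
    (fun φ => by
      rw [hS]
      have h1 : (core.inner φ φ).re = cochainNormSq μ R n φ.1 := cochainInner_self_re φ.1
      rw [h1, hcast, Complex.re_ofReal_mul, cochainInner_self_re, mul_assoc]
      exact mul_le_mul_of_nonneg_left (hgap φ.1 φ.2) (by positivity))
    ⟨φ, hφ⟩
  exact ⟨codifferential n ρ j z.1, congrArg Subtype.val hz⟩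

end

theorem isZero_homology_of_exact (ρ : G →* (H ≃ₗᵢ[ℂ] H)) (j : ℕ)
    (h : ∀ φ : cochains ρ (j + 1), cochainDifferential ρ (j + 1) φ = 0 →
      ∃ ψ, cochainDifferential ρ j ψ = φ) :
    CategoryTheory.Limits.IsZero ((cochainComplex ρ).homology (j + 1)) := by
  rw [← HomologicalComplex.exactAt_iff_isZero_homology,
    HomologicalComplex.exactAt_iff' _ j (j + 1) (j + 2) (by simp) (by simp),
    CategoryTheory.ShortComplex.moduleCat_exact_iff]
  have hd (i : ℕ) : (cochainComplex ρ).d i (i + 1) = ModuleCat.ofHom (cochainDifferential ρ i) :=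
    CochainComplex.of_d (fun i => ModuleCat.of ℂ (cochains ρ i))
      (fun i => ModuleCat.ofHom (cochainDifferential ρ i)) i
  intro φ hφ
  change ((cochainComplex ρ).d (j + 1) (j + 2)).hom φ = 0 at hφ
  rw [hd (j + 1)] at hφ
  obtain ⟨ψ, hψ⟩ := h φ hφ
  refine ⟨ψ, ?_⟩
  change ((cochainComplex ρ).d j (j + 1)).hom ψ = φ
  rw [hd j]
  exact hψ

end AbstractSimplicialComplex

theorem theorem3p1 {V : Type u} (X : AbstractSimplicialComplex V) [X.IsLocallyFinite]
    (n : ℕ) (hpure : X.IsPure n)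
    (G : Subgroup X.Aut) (hclosed : IsClosed (G : Set X.Aut))
    (hproper : X.IsConnected ∨
      ∀ x : V, IsCompact (AbstractSimplicialComplex.vertexStabilizer G x))
    (hcocompact : AbstractSimplicialComplex.IsCocompact G)
    (hunimodular : IsUnimodularGroup G)
    (k : ℕ) (hk : 1 ≤ k) (hkn : k + 1 ≤ n)
    (hlink : ∀ τ : X.faces, τ.1.card = k →
      (X.link τ).IsConnected ∧
        (k : ℝ) * ((n : ℝ) - (k : ℝ)) / ((k : ℝ) + 1) < X.kappa n τ)
    {H : Type v} [NormedAddCommGroup H] [InnerProductSpace ℂ H] [CompleteSpace H]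
    (ρ : G →* (H ≃ₗᵢ[ℂ] H)) :
    CategoryTheory.Limits.IsZero ((AbstractSimplicialComplex.cochainComplex ρ).homology k) := by

  let _ : MeasurableSpace G := borel G
  have : BorelSpace G := ⟨rfl⟩
  obtain ⟨μ, hμ, hμr⟩ := hunimodular
  obtain ⟨j, rfl⟩ : ∃ j, k = j + 1 := ⟨k - 1, by omega⟩
  have hcompact (x : V) : IsCompact (AbstractSimplicialComplex.vertexStabilizer G x) :=
    hproper.elim (fun h => AbstractSimplicialComplex.isCompact_vertexStabilizer h hclosed x)
      fun h => h x
  choose R hR using fun j => hcocompact.exists_finset j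
  have hcover : AbstractSimplicialComplex.IsOrbitCover μ R :=
    ⟨AbstractSimplicialComplex.isProperSmul hcompact μ, hR⟩
  obtain ⟨ε, hε, hgap⟩ := hcover.exists_mul_cochainNormSq_le (ρ := ρ) hpure (j := j) hkn
    fun τ hτ => by
      have h := hlink τ hτ
      push_cast at h
      rwa [add_assoc (j : ℝ) 1 1, one_add_one_eq_two] at h
  exact AbstractSimplicialComplex.isZero_homology_of_exact ρ j fun φ hφ =>
    hcover.exists_cochainDifferential_eq hpure hε hgap hφ
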